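/- Let $\mathcal{H}$ be a separable complex Hilbert space; a state is a positive semi-definite trace-class operator of trace one on $\mathcal{H}$. For states $\rho,\sigma$ let $F(\rho,\sigma)=\|\sqrt{\rho}\sqrt{\sigma}\|_1^2$ and $F_{\mathrm H}(\rho,\sigma)=(\operatorname{Tr}[\sqrt{\rho}\sqrt{\sigma}])^2$, where $\|A\|_1=\operatorname{Tr}\sqrt{A^\dagger A}$. For an ensemble $\mathcal{S}=\{(p_m,\rho_m)\}_{m=1}^M$ of $M\ge 2$ states on $\mathcal{H}$ with prior probabilities $p_m>0$, $\sum_m p_m=1$, and for $n\in\mathbb{N}=\{1,2,\dots\}$, let $$p_e(\mathcal{S},n)=\inf_{(\Lambda_1,\dots,\Lambda_M)}\ \sum_{m=1}^M p_m\operatorname{Tr}\!\left[(I^{\otimes n}-\Lambda_m)\rho_m^{\otimes n}\right],$$ the infimum being over all POVMs on $\mathcal{H}^{\otimes n}$ ($\Lambda_m\ge 0$, $\sum_m\Lambda_m=I^{\otimes n}$), and let $n^*(\mathcal{S},\varepsilon)=\inf\{n\in\mathbb{N}: p_e(\mathcal{S},n)\le\varepsilon\}\in\mathbb{N}\cup\{\infty\}$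 be the sample complexity. For every $\varepsilon\in(0,1]$ there are constants $c,C>0$, depending only on $\varepsilon$, such that for all $\mathcal{H}$, $M\ge2$ and $\mathcal{S}$ as above with $$\frac{p_m p_{\bar m}}{p_m+p_{\bar m}}\ \ge\ \varepsilon\qquad\text{for all } m\ne\bar m,$$ one has $$\frac{c}{\min_{m\ne\bar m}[-\ln F(\rho_m,\rho_{\bar m})]}\ \le\ n^*(\mathcal{S},\varepsilon)\ \le\ \max\left\{1,\ \frac{C\ln M}{\min_{m\ne\bar m}[-\ln F(\rho_m,\rho_{\bar m})]}\right\},$$ and the same two bounds hold with $F_{\mathrm H}$ in place of $F$. Here $-\ln 0=\infty$, $1/\infty=0$ and $1/0=\infty$. -/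

import Mathlib

open scoped TensorProduct ENNReal InnerProductSpace

universe u

noncomputable section

namespace QHT

/-! ### Hilbert spaces and their tensor powers -/

/-- A complex Hilbert space, bundled. -/
structure HilbSp : Type (u + 1) where
  carrier : Type u
  [normed : NormedAddCommGroup carrier]
  [innerProd : InnerProductSpace ℂ carrier]
  [complete : CompleteSpace carrier]

instance : CoeSort HilbSp.{u} (Type u) := ⟨HilbSp.carrier⟩

instance (X : HilbSp.{u}) : NormedAddCommGroup X := X.normed

instance (X : HilbSp.{u}) : InnerProductSpace ℂ X := X.innerProd

instance (X : HilbSp.{u}) : CompleteSpace X := X.complete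

/-- Bounded linear operators on a Hilbert space. -/
abbrev Op (X : Type u) [NormedAddCommGroup X] [InnerProductSpace ℂ X] : Type u := X →L[ℂ] X

/-- The one-dimensional Hilbert space `ℂ` (placed in the universe `u`). -/
def unitSp : HilbSp.{u} := ⟨EuclideanSpace ℂ PUnit.{u + 1}⟩

/-- The Hilbert space tensor product: the completion of the algebraic tensor product for the inner
product with `⟪x ⊗ y, x' ⊗ y'⟫ = ⟪x, x'⟫ * ⟪y, y'⟫`. -/
def tensorSp (X Y : HilbSp.{u}) : HilbSp.{u} := ⟨UniformSpace.Completion (X ⊗[ℂ] Y)⟩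

/-- The operator `A ⊗ B` on the Hilbert space tensor product: the continuous extension of
`x ⊗ y ↦ A x ⊗ B y`. -/
def tensorOp {X Y : HilbSp.{u}} (A : Op X) (B : Op Y) : Op (tensorSp X Y) :=
  (TensorProduct.mapL A B).completion

/-- The `n`-fold tensor power of a Hilbert space. -/
def powSp (X : HilbSp.{u}) : ℕ → HilbSp.{u}
  | 0 => unitSp
  | n + 1 => tensorSp X (powSp X n)

/-- The `n`-fold tensor power of an operator. -/
def powOp {X : HilbSp.{u}} (A : Op X) : (n : ℕ) → Op (powSp X n)
  | 0 => ContinuousLinearMap.id ℂ (unitSp : HilbSp.{u})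
  | n + 1 => tensorOp A (powOp A n)

section Operators

variable {X : Type u} [NormedAddCommGroup X] [InnerProductSpace ℂ X] [CompleteSpace X]

/-! ### Trace, states, fidelities -/

variable (X) in
/-- The index set of a fixed orthonormal basis of the Hilbert space `X`. -/
def basisIndex : Set X := (exists_hilbertBasis ℂ X).choose

variable (X) in
/-- A fixed orthonormal basis of the Hilbert space `X`. -/
def basis : HilbertBasis (basisIndex X) ℂ X := (exists_hilbertBasis ℂ X).choose_spec.choose

/-- The trace `∑ i, ⟪e i, A e i⟫` of a trace-class operator (for which the sum converges absolutely
and does not depend on the orthonormal basis). -/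
def trace (A : Op X) : ℂ := ∑' i, ⟪basis X i, A (basis X i)⟫_ℂ

/-- A quantum state: a positive semidefinite operator with a convergent trace, equal to one. -/
structure IsState (ρ : Op X) : Prop where
  isPositive : ρ.IsPositive
  hasSum_trace : HasSum (fun i => ⟪basis X i, ρ (basis X i)⟫_ℂ) 1

/-- The trace norm `‖A‖₁ = Tr √(A† A)` of a trace-class operator. -/
def traceNorm (A : Op X) : ℝ := (trace (CFC.sqrt (star A * A))).re

/-- The (Uhlmann) fidelity `F(ρ, σ) = ‖√ρ √σ‖₁²`. -/
def fidelity (ρ σ : Op X) : ℝ := traceNorm (CFC.sqrt ρ * CFC.sqrt σ) ^ 2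

/-- The Holevo fidelity `F_H(ρ, σ) = (Tr[√ρ √σ])²` (the trace is real here). -/
def holevoFidelity (ρ σ : Op X) : ℝ := (trace (CFC.sqrt ρ * CFC.sqrt σ)).re ^ 2

end Operators

/-- `-ln x` in `[0, ∞]` for `x ∈ [0, 1]`, with `-ln 0 = ∞`. -/
def negLog (x : ℝ) : ℝ≥0∞ := if x ≤ 0 then ∞ else ENNReal.ofReal (-Real.log x)

/-- `min_{m ≠ m'} [-ln G(ρ_m, ρ_m')]` for a function `G` of two operators. -/
def minNegLog {X : HilbSp.{u}} {M : ℕ} (G : Op X → Op X → ℝ) (ρ : Fin M → Op X) : ℝ≥0∞ :=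
  ⨅ (m : Fin M) (m' : Fin M) (_ : m ≠ m'), negLog (G (ρ m) (ρ m'))

/-! ### `M`-ary quantum hypothesis testing -/

/-- A positive operator-valued measure with `M` outcomes on `X`. -/
structure POVM (X : HilbSp.{u}) (M : ℕ) where
  op : Fin M → Op X
  isPositive : ∀ m, (op m).IsPositive
  sum_eq : ∑ m, op m = 1

/-- The error probability, on `n` copies of the unknown state, of a fixed measurement. -/
def errorOf {X : HilbSp.{u}} {M : ℕ} (p : Fin M → ℝ) (ρ : Fin M → Op X) (n : ℕ)
    (Λ : POVM (powSp X n) M) : ℝ :=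
  ∑ m, p m * (trace ((1 - Λ.op m) * powOp (ρ m) n)).re

/-- The minimum error probability `p_e(S, n)` of `M`-ary hypothesis testing on `n` copies. -/
def minError {X : HilbSp.{u}} {M : ℕ} (p : Fin M → ℝ) (ρ : Fin M → Op X) (n : ℕ) : ℝ :=
  ⨅ Λ : POVM (powSp X n) M, errorOf p ρ n Λ

/-- The sample complexity `n^*(S, ε)`: the least `n ∈ {1, 2, …}` with `p_e(S, n) ≤ ε`, and `∞` if
there is none. -/
def sampleComplexity {X : HilbSp.{u}} {M : ℕ} (p : Fin M → ℝ) (ρ : Fin M → Op X) (ε : ℝ) : ℕ∞ :=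
  ⨅ (n : ℕ) (_ : 1 ≤ n ∧ minError p ρ n ≤ ε), (n : ℕ∞)

/-- An ensemble of `M` states on `X` with (positive) prior probabilities `p`. -/
structure IsEnsemble {X : HilbSp.{u}} {M : ℕ} (p : Fin M → ℝ) (ρ : Fin M → Op X) : Prop where
  prior_pos : ∀ m, 0 < p m
  prior_sum : ∑ m, p m = 1
  isState : ∀ m, IsState (ρ m)

end QHT

end

noncomputable section

namespace QHT

section HilbertSchmidt

variable {X : Type u} [NormedAddCommGroup X] [InnerProductSpace ℂ X] [CompleteSpace X]

/-! ### Hilbert-Schmidt operators -/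

/-! All estimates are made on square roots of states. These are Hilbert-Schmidt operators of norm
one, and the trace of a product of two Hilbert-Schmidt operators is an inner product. It therefore
converges, is cyclic and obeys Cauchy-Schwarz in any dimension.

Lower bound, proved for `F`: if a POVM has error about `ε`, its element `Λ_m` separates `ρ_m` from
every other `ρ_k`. The prior condition makes guessing from the priors no better than `ε`, so the two
acceptance probabilities differ by at least `ε / 2`. Fuchs-van de Graaf (`traceNorm_sq_le`) and
multiplicativity of the trace norm then give `F ^ n ≤ 1 - ε ^ 2 / 4`, and `log y ≤ y - 1` bounds `n`
from below.

Upper bound, proved for `F_H`: the operators `A m = √ρ_m ^ ⊗n` have overlaps `Tr (A m * A k) = (Tr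
√ρ_m √ρ_k) ^ n ≤ δ`. The positive part of a difference gives a projective test between two of them
(`exists_binary_test`). Testing each `A m` against the sum of the others and running the tests in
sequence gives a measurement with error at most `6 * M * √(M * δ)` (`exists_measurement`). The prior
condition forces `M * ε ≤ 1`, so a `δ` depending only on `ε` suffices, and `ln M` enters only
through `ln M ≥ ln 2`.

Since `F_H ≤ F`, the lower bound passes from `F` to `F_H` and the upper bound from `F_H` to `F`. -/

omit [CompleteSpace X] in
theorem tsum_enorm_inner_sq {ι : Type*} (b : HilbertBasis ι ℂ X) (x : X) :
    ∑' i, ‖⟪b i, x⟫_ℂ‖ₑ ^ 2 = ‖x‖ₑ ^ 2 := by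
  have h : HasSum (fun i => ‖⟪b i, x⟫_ℂ‖ ^ 2) (‖x‖ ^ 2) := by
    have := (b.hasSum_inner_mul_inner x x).mapL Complex.reCLM
    convert this using 1
    · ext i
      rw [← inner_conj_symm x, ← Complex.normSq_eq_conj_mul_self]
      rw [Complex.normSq_eq_norm_sq]
      exact (Complex.ofReal_re _).symm
    · simpa using (inner_self_eq_norm_sq (𝕜 := ℂ) x).symm
  have h2 := ENNReal.ofReal_tsum_of_nonneg (fun i => by positivity) h.summable
  rw [h.tsum_eq] at h2
  simp only [ENNReal.ofReal_pow (norm_nonneg _), ofReal_norm] at h2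
  exact h2.symm

/-- By Parseval both sides are the double sum of `|⟪c j, A (b i)⟫| ^ 2`. The two bases are
unrelated, so this yields at once basis independence and invariance under the adjoint. -/
theorem tsum_enorm_sq_adjoint {ι κ : Type*} (b : HilbertBasis ι ℂ X) (c : HilbertBasis κ ℂ X)
    (A : Op X) : ∑' i, ‖A (b i)‖ₑ ^ 2 = ∑' j, ‖(star A) (c j)‖ₑ ^ 2 := by
  simp_rw [← tsum_enorm_inner_sq c (A _), ← tsum_enorm_inner_sq b ((star A) _)]
  rw [ENNReal.tsum_comm]
  refine tsum_congr fun j => tsum_congr fun i => ?_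
  rw [ContinuousLinearMap.star_eq_adjoint, ContinuousLinearMap.adjoint_inner_right,
    ← inner_conj_symm, RCLike.enorm_conj]

/-- The squared Hilbert-Schmidt norm. -/
def hsSq (A : Op X) : ℝ≥0∞ := ∑' i, ‖A (basis X i)‖ₑ ^ 2

theorem hsSq_eq_tsum {ι : Type*} (b : HilbertBasis ι ℂ X) (A : Op X) :
    hsSq A = ∑' i, ‖A (b i)‖ₑ ^ 2 := by
  rw [hsSq, tsum_enorm_sq_adjoint (basis X) b, tsum_enorm_sq_adjoint b b, star_star]

theorem hsSq_star (A : Op X) : hsSq (star A) = hsSq A :=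
  (tsum_enorm_sq_adjoint (basis X) (basis X) A).symm

theorem hsSq_mul_le (T A : Op X) : hsSq (T * A) ≤ ‖T‖ₑ ^ 2 * hsSq A := by
  rw [hsSq, hsSq, ← ENNReal.tsum_mul_left]
  refine ENNReal.tsum_le_tsum fun i => ?_
  rw [← mul_pow]
  gcongr
  exact T.le_opENorm _

theorem hsSq_smul (c : ℂ) (A : Op X) : hsSq (c • A) = ‖c‖ₑ ^ 2 * hsSq A := by
  rw [hsSq, hsSq, ← ENNReal.tsum_mul_left]
  refine tsum_congr fun i => ?_
  rw [← mul_pow, smul_apply, enorm_smul]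

/-- An operator is Hilbert-Schmidt if its Hilbert-Schmidt norm is finite. -/
def IsHS (A : Op X) : Prop := hsSq A ≠ ∞

/-- The Hilbert-Schmidt norm (zero for operators that are not Hilbert-Schmidt). -/
def hsNorm (A : Op X) : ℝ := √(hsSq A).toReal

theorem hsNorm_nonneg (A : Op X) : 0 ≤ hsNorm A := Real.sqrt_nonneg _

theorem hsNorm_sq (A : Op X) : hsNorm A ^ 2 = (hsSq A).toReal :=
  Real.sq_sqrt ENNReal.toReal_nonneg

theorem hsNorm_star (A : Op X) : hsNorm (star A) = hsNorm A := by
  rw [hsNorm, hsNorm, hsSq_star]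

theorem hsNorm_smul (c : ℂ) (A : Op X) : hsNorm (c • A) = ‖c‖ * hsNorm A := by
  rw [hsNorm, hsSq_smul, ENNReal.toReal_mul, Real.sqrt_mul (by positivity), hsNorm]
  simp

theorem hsNorm_neg (A : Op X) : hsNorm (-A) = hsNorm A := by
  simpa using hsNorm_smul (-1) A

theorem hsNorm_sub_comm (A B : Op X) : hsNorm (A - B) = hsNorm (B - A) := by
  rw [← neg_sub, hsNorm_neg]

namespace IsHS

theorem memℓp {ι : Type*} (b : HilbertBasis ι ℂ X) {A : Op X} (hA : IsHS A) :
    Memℓp (fun i => A (b i)) 2 := by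
  refine memℓp_gen ?_
  have h := ENNReal.summable_toReal (hsSq_eq_tsum b A ▸ hA : ∑' i, ‖A (b i)‖ₑ ^ 2 ≠ ∞)
  simpa using h

/-- The square-summable family of columns of a Hilbert-Schmidt operator. -/
def toLp {ι : Type*} (b : HilbertBasis ι ℂ X) {A : Op X} (hA : IsHS A) :
    lp (fun _ : ι => X) 2 := ⟨fun i => A (b i), hA.memℓp b⟩

theorem norm_toLp {ι : Type*} (b : HilbertBasis ι ℂ X) {A : Op X} (hA : IsHS A) :
    ‖hA.toLp b‖ = hsNorm A := by
  have h := lp.norm_rpow_eq_tsum (p := 2) (by simp) (hA.toLp b)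
  rw [hsNorm, hsSq_eq_tsum b, ENNReal.tsum_toReal_eq (fun i => by finiteness)]
  simp only [ENNReal.toReal_ofNat, Real.rpow_ofNat] at h
  rw [eq_comm, Real.sqrt_eq_iff_mul_self_eq (by positivity) (by positivity), ← sq, h]
  simp [toLp]

theorem of_memℓp {A : Op X} (h : Memℓp (fun i => A (basis X i)) 2) : IsHS A := by
  have h1 := h.summable (by simp)
  have h2 := h1.tsum_ofReal_ne_top
  simpa [IsHS, hsSq, ENNReal.ofReal_pow] using h2

protected theorem add {A B : Op X} (hA : IsHS A) (hB : IsHS B) : IsHS (A + B) :=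
  of_memℓp (Memℓp.add (hA.memℓp (basis X)) (hB.memℓp (basis X)))

protected theorem star {A : Op X} (hA : IsHS A) : IsHS (star A) := by rwa [IsHS, hsSq_star]

protected theorem smul {A : Op X} (hA : IsHS A) (c : ℂ) : IsHS (c • A) := by
  rw [IsHS, hsSq_smul]; exact ENNReal.mul_ne_top (by finiteness) hA

protected theorem neg {A : Op X} (hA : IsHS A) : IsHS (-A) := by simpa using hA.smul (-1)

protected theorem sub {A B : Op X} (hA : IsHS A) (hB : IsHS B) : IsHS (A - B) := by
  rw [sub_eq_add_neg]; exact hA.add hB.neg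

theorem mul_left {A : Op X} (hA : IsHS A) (T : Op X) : IsHS (T * A) :=
  ne_top_of_le_ne_top (ENNReal.mul_ne_top (by finiteness) hA) (hsSq_mul_le T A)

theorem mul_right {A : Op X} (hA : IsHS A) (T : Op X) : IsHS (A * T) := by
  simpa using (hA.star.mul_left (Star.star T)).star

end IsHS

theorem isHS_zero : IsHS (0 : Op X) := by simp [IsHS, hsSq]

theorem isHS_sum {ι : Type*} (s : Finset ι) {A : ι → Op X} (h : ∀ i ∈ s, IsHS (A i)) :
    IsHS (∑ i ∈ s, A i) := by
  classical
  induction s using Finset.induction_on with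
  | empty => simpa using isHS_zero
  | insert i s hi ih =>
    rw [Finset.sum_insert hi]
    exact (h i (by simp)).add (ih fun j hj => h j (by simp [hj]))

theorem hsNorm_mul_le {A : Op X} (hA : IsHS A) (T : Op X) :
    hsNorm (T * A) ≤ ‖T‖ * hsNorm A := by
  rw [hsNorm, hsNorm, Real.sqrt_le_left (by positivity), mul_pow,
    Real.sq_sqrt ENNReal.toReal_nonneg]
  have h := ENNReal.toReal_mono (ENNReal.mul_ne_top (by finiteness) hA) (hsSq_mul_le T A)
  simpa using h

theorem hsNorm_mul_le_of_norm_le_one {A T : Op X} (hA : IsHS A) (hT : ‖T‖ ≤ 1) :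
    hsNorm (T * A) ≤ hsNorm A :=
  (hsNorm_mul_le hA T).trans (mul_le_of_le_one_left (hsNorm_nonneg A) hT)

theorem hsNorm_mul_right_le_of_norm_le_one {A T : Op X} (hA : IsHS A) (hT : ‖T‖ ≤ 1) :
    hsNorm (A * T) ≤ hsNorm A := by
  rw [← hsNorm_star, ← hsNorm_star A, star_mul]
  exact hsNorm_mul_le_of_norm_le_one hA.star (by rwa [norm_star])

theorem hsNorm_add_le {A B : Op X} (hA : IsHS A) (hB : IsHS B) :
    hsNorm (A + B) ≤ hsNorm A + hsNorm B := by
  rw [← (hA.add hB).norm_toLp (basis X), ← hA.norm_toLp (basis X), ← hB.norm_toLp (basis X)]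
  exact norm_add_le (hA.toLp (basis X)) (hB.toLp (basis X))

theorem hsNorm_sub_le {A B : Op X} (hA : IsHS A) (hB : IsHS B) :
    hsNorm (A - B) ≤ hsNorm A + hsNorm B := by
  rw [sub_eq_add_neg, ← hsNorm_neg B]; exact hsNorm_add_le hA hB.neg

/-! ### The trace of a product of two Hilbert-Schmidt operators -/

/-- The Hilbert-Schmidt inner product, expressed by polarization. -/
def hsInner (A B : Op X) : ℂ :=
  ((hsNorm (A + B) : ℂ) ^ 2 - (hsNorm (A - B) : ℂ) ^ 2 +
    ((hsNorm (A - Complex.I • B) : ℂ) ^ 2 - (hsNorm (A + Complex.I • B) : ℂ) ^ 2) * Complex.I) / 4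

/-- Polarization reduces the inner product to norms, which do not depend on `b`; hence neither does
the trace of a product. -/
theorem inner_toLp {ι : Type*} (b : HilbertBasis ι ℂ X) {A B : Op X} (hA : IsHS A)
    (hB : IsHS B) : ⟪hA.toLp b, hB.toLp b⟫_ℂ = hsInner A B := by
  rw [inner_eq_sum_norm_sq_div_four, hsInner, ← (hA.add hB).norm_toLp b,
    ← (hA.sub hB).norm_toLp b, ← (hA.sub (hB.smul Complex.I)).norm_toLp b,
    ← (hA.add (hB.smul Complex.I)).norm_toLp b]
  rfl

theorem hasSum_hsInner {ι : Type*} (b : HilbertBasis ι ℂ X) {A B : Op X} (hA : IsHS A)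
    (hB : IsHS B) : HasSum (fun i => ⟪A (b i), B (b i)⟫_ℂ) (hsInner A B) := by
  rw [← inner_toLp b hA hB]
  exact lp.hasSum_inner (hA.toLp b) (hB.toLp b)

/-- The source of cyclicity of the trace: every norm in the polarization formula is unchanged by the
adjoint and by factors `±I`. -/
theorem hsInner_star_star (A B : Op X) : hsInner (star A) (star B) = hsInner B A := by
  have h1 : star A - Complex.I • star B = star (Complex.I • (B - Complex.I • A)) := by
    simp only [star_smul, star_sub, smul_sub, smul_smul]
    simp [sub_eq_add_neg, add_comm]
  have h2 : star A + Complex.I • star B = star ((-Complex.I) • (B + Complex.I • A)) := by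
    simp only [star_smul, star_add, smul_add, smul_smul]
    simp [add_comm]
  rw [hsInner, hsInner, h1, h2, ← star_add, ← star_sub]
  simp only [hsNorm_star, hsNorm_smul, norm_neg, Complex.norm_I, one_mul]
  rw [add_comm A B, hsNorm_sub_comm A B]

theorem hasSum_trace_mul {ι : Type*} (b : HilbertBasis ι ℂ X) {A B : Op X} (hA : IsHS A)
    (hB : IsHS B) : HasSum (fun i => ⟪b i, (A * B) (b i)⟫_ℂ) (hsInner (star A) B) := by
  convert hasSum_hsInner b hA.star hB using 1
  ext i
  rw [ContinuousLinearMap.star_eq_adjoint, ContinuousLinearMap.adjoint_inner_left]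
  rfl

theorem trace_mul_eq_hsInner {A B : Op X} (hA : IsHS A) (hB : IsHS B) :
    trace (A * B) = hsInner (star A) B :=
  (hasSum_trace_mul (basis X) hA hB).tsum_eq

theorem trace_mul_comm {A B : Op X} (hA : IsHS A) (hB : IsHS B) :
    trace (A * B) = trace (B * A) := by
  rw [trace_mul_eq_hsInner hA hB, trace_mul_eq_hsInner hB hA, ← hsInner_star_star, star_star]

theorem norm_trace_mul_le {A B : Op X} (hA : IsHS A) (hB : IsHS B) :
    ‖trace (A * B)‖ ≤ hsNorm A * hsNorm B := by
  rw [trace_mul_eq_hsInner hA hB, ← inner_toLp (basis X) hA.star hB, ← hsNorm_star A,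
    ← hA.star.norm_toLp (basis X), ← hB.norm_toLp (basis X)]
  exact norm_inner_le_norm _ _

theorem re_trace_mul_le {A B : Op X} (hA : IsHS A) (hB : IsHS B) :
    (trace (A * B)).re ≤ hsNorm A * hsNorm B :=
  (Complex.re_le_norm _).trans (norm_trace_mul_le hA hB)

theorem trace_star_mul_self {A : Op X} (hA : IsHS A) :
    trace (star A * A) = ((hsNorm A ^ 2 : ℝ) : ℂ) := by
  rw [trace_mul_eq_hsInner hA.star hA, star_star, ← inner_toLp (basis X) hA hA,
    inner_self_eq_norm_sq_to_K, hA.norm_toLp]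
  simp

theorem trace_mul_add {A B C : Op X} (hA : IsHS A) (hB : IsHS B) (hC : IsHS C) :
    trace (A * (B + C)) = trace (A * B) + trace (A * C) := by
  have h := (hasSum_trace_mul (basis X) hA hB).add (hasSum_trace_mul (basis X) hA hC)
  rw [trace_mul_eq_hsInner hA hB, trace_mul_eq_hsInner hA hC, ← h.tsum_eq]
  refine tsum_congr fun i => ?_
  rw [← inner_add_right, mul_add]; rfl

theorem trace_mul_sub {A B C : Op X} (hA : IsHS A) (hB : IsHS B) (hC : IsHS C) :
    trace (A * (B - C)) = trace (A * B) - trace (A * C) := by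
  rw [eq_sub_iff_add_eq, ← trace_mul_add hA (hB.sub hC) hC, sub_add_cancel]

theorem trace_mul_sum {ι : Type*} (s : Finset ι) {A : Op X} {B : ι → Op X} (hA : IsHS A)
    (hB : ∀ i ∈ s, IsHS (B i)) : trace (A * ∑ i ∈ s, B i) = ∑ i ∈ s, trace (A * B i) := by
  classical
  induction s using Finset.induction_on with
  | empty => simp [trace]
  | insert i s hi ih =>
    have hs : ∀ j ∈ s, IsHS (B j) := fun j hj => hB j (by simp [hj])
    rw [Finset.sum_insert hi, Finset.sum_insert hi,
      trace_mul_add hA (hB i (by simp)) (isHS_sum s hs), ih hs]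

theorem trace_star (A : Op X) : trace (star A) = star (trace A) := by
  rw [trace, trace, tsum_star]
  refine tsum_congr fun i => ?_
  rw [ContinuousLinearMap.star_eq_adjoint, ContinuousLinearMap.adjoint_inner_right]
  exact (inner_conj_symm _ _).symm

theorem re_trace_star (A : Op X) : (trace (star A)).re = (trace A).re := by
  rw [trace_star]; simp

/-! ### Positivity of the trace of a product -/

theorem re_trace_nonneg_of_isPositive {A : Op X} (hA : A.IsPositive) : 0 ≤ (trace A).re := by
  by_cases h : Summable fun i => ⟪basis X i, A (basis X i)⟫_ℂ
  · rw [trace, Complex.re_tsum h]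
    exact tsum_nonneg fun i => hA.re_inner_nonneg_right _
  · rw [trace, tsum_eq_zero_of_not_summable h]; simp

/-- The orthogonal projection onto the closed span of finitely many basis vectors. -/
def truncProj (s : Finset (basisIndex X)) : Op X :=
  (Submodule.span ℂ (basis X '' s)).topologicalClosure.starProjection

theorem star_truncProj (s : Finset (basisIndex X)) :
    star (truncProj s : Op X) = truncProj s :=
  isStarProjection_starProjection.isSelfAdjoint

theorem norm_truncProj_le (s : Finset (basisIndex X)) : ‖(truncProj s : Op X)‖ ≤ 1 :=
  Submodule.starProjection_norm_le _

open Classical in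
theorem truncProj_basis (s : Finset (basisIndex X)) (i : basisIndex X) :
    truncProj s (basis X i) = if i ∈ s then basis X i else 0 := by
  split_ifs with h
  · refine Submodule.starProjection_eq_self_iff.2 (Submodule.le_topologicalClosure _ ?_)
    exact Submodule.subset_span ⟨i, h, rfl⟩
  · refine (Submodule.starProjection_apply_eq_zero_iff _).2 ?_
    rw [Submodule.orthogonal_closure, Submodule.mem_orthogonal]
    intro u hu
    induction hu using Submodule.span_induction with
    | mem x hx =>
      obtain ⟨j, hj, rfl⟩ := hx
      exact (basis X).orthonormal.2 fun hij => h (hij ▸ hj)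
    | zero => simp
    | add x y _ _ hx hy => rw [inner_add_left, hx, hy, add_zero]
    | smul c x _ hx => rw [inner_smul_left, hx, mul_zero]

open Classical in
theorem isHS_truncProj (s : Finset (basisIndex X)) : IsHS (truncProj s : Op X) := by
  rw [IsHS, hsSq, tsum_eq_sum (s := s) (fun i hi => by simp [truncProj_basis, hi])]
  exact ENNReal.sum_ne_top.2 fun i _ => by finiteness

open Classical in
theorem tendsto_hsNorm_sub_mul_truncProj {A : Op X} (hA : IsHS A) :
    Filter.Tendsto (fun s : Finset (basisIndex X) => hsNorm (A - A * truncProj s))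
      Filter.atTop (nhds 0) := by
  have h : ∀ s : Finset (basisIndex X), hsSq (A - A * truncProj s) =
      ∑' i : {i // i ∉ s}, ‖A (basis X i)‖ₑ ^ 2 := fun s => by
    rw [hsSq, ← tsum_subtype_eq_of_support_subset (s := {i | i ∉ s})]
    · refine tsum_congr fun i => ?_
      simp [truncProj_basis, show (i : basisIndex X) ∉ s from i.2]
    · intro i hi his
      simp [truncProj_basis, his] at hi
  simp only [hsNorm, h]
  have h2 := ENNReal.tendsto_tsum_compl_atTop_zero hA
  have h3 := (ENNReal.tendsto_toReal ENNReal.zero_ne_top).comp h2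
  simpa [Function.comp_def] using (Real.continuous_sqrt.tendsto 0).comp h3

theorem re_trace_mul_star_nonneg {B : Op X} (hB : B.IsPositive) (C : Op X) :
    0 ≤ (trace (C * B * star C)).re :=
  re_trace_nonneg_of_isPositive (by
    rw [mul_assoc]
    exact hB.conj_adjoint C)

-- Formally `Tr (A B) = Tr (√A B √A)`, but `√A` need not be Hilbert-Schmidt, so cyclicity cannot be
-- used directly. It applies to `√A Q` with `Q` a finite-rank projection; then `Q A Q → A` in
-- Hilbert-Schmidt norm.
open Filter in
theorem re_trace_mul_nonneg {A B : Op X} (hA : IsHS A) (hB : IsHS B) (hA' : A.IsPositive)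
    (hB' : B.IsPositive) : 0 ≤ (trace (A * B)).re := by
  have hpos : ∀ s, 0 ≤ (trace (truncProj s * A * truncProj s * B)).re := fun s => by
    have hQ := isHS_truncProj (X := X) s
    obtain ⟨a, ha⟩ : ∃ a : Op X, star a * a = A := by
      have h0 := CFC.sqrt_nonneg A
      refine ⟨CFC.sqrt A, ?_⟩
      rw [(IsSelfAdjoint.of_nonneg h0).star_eq,
        CFC.sqrt_mul_sqrt_self A ((ContinuousLinearMap.nonneg_iff_isPositive A).2 hA')]
    have h := re_trace_mul_star_nonneg hB' (a * truncProj s)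
    rw [trace_mul_comm ((hQ.mul_left a).mul_right B) (hQ.mul_left a).star, star_mul,
      star_truncProj] at h
    simpa only [← mul_assoc, ha, mul_assoc (truncProj s) (star a) a] using h
  have hlim : Tendsto (fun s : Finset (basisIndex X) =>
      trace (A * B) - trace (truncProj s * A * truncProj s * B)) atTop (nhds 0) := by
    have h1 : ∀ s : Finset (basisIndex X),
        ‖trace (A * B) - trace (truncProj s * A * truncProj s * B)‖ ≤
          hsNorm (A - A * truncProj s) * hsNorm B + hsNorm A * hsNorm (B - B * truncProj s) := by
      intro s
      have hQ : IsHS (truncProj s : Op X) := isHS_truncProj s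
      have hA2 : hsNorm (A - truncProj s * A) = hsNorm (A - A * truncProj s) := by
        rw [← hsNorm_star]; simp [star_truncProj, hA'.isSelfAdjoint.star_eq]
      have hB2 : hsNorm (B - truncProj s * B) = hsNorm (B - B * truncProj s) := by
        rw [← hsNorm_star]; simp [star_truncProj, hB'.isSelfAdjoint.star_eq]
      have e : trace (A * B) - trace (truncProj s * A * truncProj s * B) =
          trace (B * (A - truncProj s * A)) +
            trace (truncProj s * A * (B - truncProj s * B)) := by
        rw [trace_mul_sub hB hA (hA.mul_left _), trace_mul_sub (hA.mul_left _) hB (hB.mul_left _),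
          trace_mul_comm hA hB, trace_mul_comm hB (hA.mul_left _)]
        simp only [mul_assoc]
        ring
      rw [e]
      refine (norm_add_le _ _).trans (add_le_add ?_ ?_)
      · rw [← hA2, mul_comm (hsNorm _)]
        exact norm_trace_mul_le hB (hA.sub (hA.mul_left _))
      · refine (norm_trace_mul_le (hA.mul_left _) (hB.sub (hB.mul_left _))).trans ?_
        rw [hB2]
        exact mul_le_mul_of_nonneg_right
          (hsNorm_mul_le_of_norm_le_one hA (norm_truncProj_le s)) (hsNorm_nonneg _)
    refine squeeze_zero_norm h1 ?_
    simpa using ((tendsto_hsNorm_sub_mul_truncProj hA).mul_const (hsNorm B)).add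
      ((tendsto_hsNorm_sub_mul_truncProj hB).const_mul (hsNorm A))
  have h3 := (Complex.continuous_re.tendsto 0).comp hlim
  simp only [Complex.zero_re] at h3
  have h4 : Tendsto (fun s : Finset (basisIndex X) =>
      (trace (truncProj s * A * truncProj s * B)).re) atTop (nhds (trace (A * B)).re) := by
    have := h3.const_sub (trace (A * B)).re
    simpa [Function.comp_def] using this
  exact ge_of_tendsto' h4 hpos

end HilbertSchmidt

section Tests

variable {X : Type u} [NormedAddCommGroup X] [InnerProductSpace ℂ X] [CompleteSpace X]

/-! ### Binary tests -/

/-- The spectral test between two positive Hilbert-Schmidt operators: the projection onto the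
positive part of `A - B` distinguishes `A` and `B` with total error at most `Tr (A B)`. -/
theorem exists_binary_test {A B : Op X} (hA : IsHS A) (hB : IsHS B) (hA' : A.IsPositive)
    (hB' : B.IsPositive) : ∃ P : Op X, IsStarProjection P ∧
      hsNorm ((1 - P) * A) ^ 2 + hsNorm (P * B) ^ 2 ≤ (trace (A * B)).re := by
  set D : Op X := A - B with hD
  have hDsa : IsSelfAdjoint D := hA'.isSelfAdjoint.sub hB'.isSelfAdjoint
  have hp : (0 : Op X) ≤ D⁺ := CFC.posPart_nonneg D
  have hm : (0 : Op X) ≤ D⁻ := CFC.negPart_nonneg D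
  have hdec : D⁺ - D⁻ = D := CFC.posPart_sub_negPart D hDsa
  have hpm : D⁺ * D⁻ = 0 := CFC.posPart_mul_negPart D
  have hker : IsClosed ((LinearMap.ker (D⁺).toLinearMap : Submodule ℂ X) : Set X) :=
    ContinuousLinearMap.isClosed_ker D⁺
  have : CompleteSpace (LinearMap.ker (D⁺).toLinearMap) := hker.completeSpace_coe
  -- The test is `P = 1 - R`, which projects onto the closed range of `D⁺`; thus `P D = D⁺` and `R D
  -- = -D⁻`. These identities also show that `D⁺` and `D⁻` are Hilbert-Schmidt.
  set R : Op X := (LinearMap.ker (D⁺).toLinearMap).starProjection with hRdef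
  have hR : IsStarProjection R := isStarProjection_starProjection
  have h1 : D⁺ * R = 0 := by
    ext x
    exact LinearMap.mem_ker.1
      (Submodule.starProjection_apply_mem (LinearMap.ker (D⁺).toLinearMap) x)
  have h2 : R * D⁺ = 0 := by
    have := congrArg star h1
    rwa [star_mul, hR.isSelfAdjoint.star_eq, (IsSelfAdjoint.of_nonneg hp).star_eq,
      star_zero] at this
  have h3 : R * D⁻ = D⁻ := by
    ext x
    refine Submodule.starProjection_eq_self_iff.2 (LinearMap.mem_ker.2 ?_)
    exact DFunLike.congr_fun hpm x
  have hRD : R * D = -D⁻ := by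
    rw [show R * D = R * (D⁺ - D⁻) by rw [hdec], mul_sub, h2, h3, zero_sub]
  have hPD : (1 - R) * D = D⁺ := by
    rw [sub_mul, hRD, one_mul, sub_neg_eq_add]; nth_rw 1 [← hdec]; abel
  have hDHS : IsHS D := hA.sub hB
  have hpHS : IsHS D⁺ := hPD ▸ hDHS.mul_left _
  have hmHS : IsHS D⁻ := by
    have := (hDHS.mul_left R).neg
    rwa [hRD, neg_neg] at this
  have hP : IsStarProjection (1 - R) := hR.one_sub
  have key : ∀ (Q Z : Op X), IsStarProjection Q → IsHS Z → Z.IsPositive →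
      hsNorm (Q * Z) ^ 2 = (trace (Z * (Q * Z))).re := fun Q Z hQ hZ hZ' => by
    have h := trace_star_mul_self (hZ.mul_left Q)
    rw [star_mul, hZ'.isSelfAdjoint.star_eq, hQ.isSelfAdjoint.star_eq, mul_assoc,
      ← mul_assoc Q, hQ.isIdempotentElem.eq] at h
    rw [h, Complex.ofReal_re]
  refine ⟨1 - R, hP, ?_⟩
  rw [sub_sub_cancel, key R A hR hA hA', key _ B hP hB hB']
  -- Substituting `e1` and `e2`, the total error is `Tr (A B) - Tr (A D⁻) - Tr (B D⁺)` in real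
  -- parts, and both subtracted terms are nonnegative.
  have e1 : R * A = R * B - D⁻ := by
    rw [eq_sub_iff_add_eq, ← neg_neg D⁻, ← hRD, hD, mul_sub]; abel
  have e2 : (1 - R) * B = (1 - R) * A - D⁺ := by
    rw [← hPD, hD, mul_sub (1 - R)]; abel
  have e3 : (trace (B * ((1 - R) * A))).re = (trace (A * ((1 - R) * B))).re := by
    rw [← re_trace_star, star_mul, star_mul, hA'.isSelfAdjoint.star_eq,
      hB'.isSelfAdjoint.star_eq, hP.isSelfAdjoint.star_eq, mul_assoc]
  have e4 : (trace (A * ((1 - R) * B))).re = (trace (A * B)).re - (trace (A * (R * B))).re := by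
    rw [sub_mul, one_mul, trace_mul_sub hA hB (hB.mul_left _), Complex.sub_re]
  rw [e1, e2, trace_mul_sub hA (hB.mul_left _) hmHS, trace_mul_sub hB (hA.mul_left _) hpHS,
    Complex.sub_re, Complex.sub_re, e3, e4]
  have p1 := re_trace_mul_nonneg hA hmHS hA' ((ContinuousLinearMap.nonneg_iff_isPositive _).1 hm)
  have p2 := re_trace_mul_nonneg hB hpHS hB' ((ContinuousLinearMap.nonneg_iff_isPositive _).1 hp)
  linarith

/-! ### Polar decomposition and the trace norm -/

/-- Douglas factorization: `A x ↦ B x` is a well-defined contraction on the range of `A`. It extends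
to the closure and is precomposed with the orthogonal projection. Applied in both directions to `A`
and `|A|`, it replaces the polar decomposition. -/
theorem exists_contraction_mul_eq {A B : Op X} (h : ∀ x, ‖B x‖ ≤ ‖A x‖) :
    ∃ W : Op X, ‖W‖ ≤ 1 ∧ W * A = B := by
  set K : Submodule ℂ X := (LinearMap.range A.toLinearMap).topologicalClosure with hK
  have hmem : ∀ x, A x ∈ K := fun x => Submodule.le_topologicalClosure _ ⟨x, rfl⟩
  let e : X →ₗ[ℂ] K := A.toLinearMap.codRestrict K hmem
  have hd : DenseRange e := by
    intro y
    rw [Metric.mem_closure_iff]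
    intro ε hε
    obtain ⟨z, ⟨x, rfl⟩, hz⟩ := Metric.mem_closure_iff.1 (show (y : X) ∈ closure _ from y.2) ε hε
    exact ⟨e x, ⟨x, rfl⟩, hz⟩
  have hn : ∀ x, ‖B.toLinearMap x‖ ≤ 1 * ‖e x‖ := fun x => by
    rw [one_mul]; exact h x
  refine ⟨(B.toLinearMap.extendOfNorm e).comp K.orthogonalProjectionOnto, ?_, ?_⟩
  · refine (ContinuousLinearMap.opNorm_comp_le _ _).trans ?_
    exact mul_le_one₀ (LinearMap.opNorm_extendOfNorm_le hd zero_le_one hn) (norm_nonneg _)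
      (Submodule.orthogonalProjectionOnto_norm_le K)
  · ext x
    have : K.orthogonalProjectionOnto (A x) = e x :=
      Submodule.orthogonalProjectionOnto_mem_subspace_eq_self (K := K) (e x)
    change B.toLinearMap.extendOfNorm e (K.orthogonalProjectionOnto (A x)) = B x
    rw [this, LinearMap.extendOfNorm_eq hd ⟨1, hn⟩]
    rfl

theorem norm_sqrt_star_mul_self_apply (A : Op X) (x : X) :
    ‖CFC.sqrt (star A * A) x‖ = ‖A x‖ := by
  have h0 := CFC.sqrt_nonneg (star A * A)
  have h1 : CFC.sqrt (star A * A) * CFC.sqrt (star A * A) = star A * A :=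
    CFC.sqrt_mul_sqrt_self _ (star_mul_self_nonneg A)
  have h2 : star (CFC.sqrt (star A * A)) * CFC.sqrt (star A * A) = star A * A := by
    rw [(IsSelfAdjoint.of_nonneg h0).star_eq, h1]
  have key : ∀ C : Op X, (⟪x, (star C * C) x⟫_ℂ) = ((‖C x‖ ^ 2 : ℝ) : ℂ) := fun C => by
    rw [ContinuousLinearMap.star_eq_adjoint, mul_apply_eq_comp,
      ContinuousLinearMap.adjoint_inner_right, inner_self_eq_norm_sq_to_K]
    simp
  have h3 := key (CFC.sqrt (star A * A))
  rw [h2, key A] at h3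
  have h4 : ‖A x‖ ^ 2 = ‖CFC.sqrt (star A * A) x‖ ^ 2 := by exact_mod_cast h3
  exact ((sq_eq_sq₀ (norm_nonneg _) (norm_nonneg _)).1 h4).symm

theorem isPositive_sqrt (A : Op X) : (CFC.sqrt A).IsPositive :=
  (ContinuousLinearMap.nonneg_iff_isPositive _).1 (CFC.sqrt_nonneg A)

theorem sqrt_mul_sqrt {A : Op X} (hA : A.IsPositive) : CFC.sqrt A * CFC.sqrt A = A :=
  CFC.sqrt_mul_sqrt_self A ((ContinuousLinearMap.nonneg_iff_isPositive A).2 hA)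

theorem star_sqrt (A : Op X) : star (CFC.sqrt A) = CFC.sqrt A :=
  (isPositive_sqrt A).isSelfAdjoint.star_eq

theorem inner_apply_eq_norm_sqrt {A : Op X} (hA : A.IsPositive) (x : X) :
    ⟪x, A x⟫_ℂ = ((‖CFC.sqrt A x‖ ^ 2 : ℝ) : ℂ) := by
  have h : ⟪x, (CFC.sqrt A * CFC.sqrt A) x⟫_ℂ = ⟪CFC.sqrt A x, CFC.sqrt A x⟫_ℂ := by
    rw [mul_apply_eq_comp]
    exact ((isPositive_sqrt A).inner_left_eq_inner_right _ _).symm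
  rw [sqrt_mul_sqrt hA] at h
  rw [h, inner_self_eq_norm_sq_to_K]
  simp

theorem hsSq_sqrt_eq_ofReal_of_hasSum {A : Op X} (hA : A.IsPositive) {t : ℂ}
    (h : HasSum (fun i => ⟪basis X i, A (basis X i)⟫_ℂ) t) :
    hsSq (CFC.sqrt A) = ENNReal.ofReal t.re := by
  have h1 := Complex.hasSum_re h
  simp only [inner_apply_eq_norm_sqrt hA, Complex.ofReal_re] at h1
  rw [← h1.tsum_eq, ENNReal.ofReal_tsum_of_nonneg (fun i => by positivity) h1.summable]
  simp [hsSq, ENNReal.ofReal_pow]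

/-- No summability is needed: if the sum diverges, both sides take the default value `0`. -/
theorem trace_eq_hsSq_sqrt {A : Op X} (hA : A.IsPositive) :
    trace A = ((hsSq (CFC.sqrt A)).toReal : ℂ) := by
  rw [trace, hsSq, ENNReal.tsum_toReal_eq (fun i => by finiteness), Complex.ofReal_tsum]
  refine tsum_congr fun i => ?_
  rw [inner_apply_eq_norm_sqrt hA]
  simp

theorem exists_contraction_sqrt_eq (A : Op X) :
    ∃ W : Op X, ‖W‖ ≤ 1 ∧ CFC.sqrt (star A * A) = W * A := by
  obtain ⟨W, h1, h2⟩ := exists_contraction_mul_eq (A := A) (B := CFC.sqrt (star A * A))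
    fun x => (norm_sqrt_star_mul_self_apply A x).le
  exact ⟨W, h1, h2.symm⟩

theorem exists_contraction_mul_sqrt_eq (A : Op X) :
    ∃ V : Op X, ‖V‖ ≤ 1 ∧ A = V * CFC.sqrt (star A * A) := by
  obtain ⟨W, h1, h2⟩ := exists_contraction_mul_eq (A := CFC.sqrt (star A * A)) (B := A)
    fun x => (norm_sqrt_star_mul_self_apply A x).ge
  exact ⟨W, h1, h2.symm⟩

/-- Write `A B = V N` with `N = |A B|` and `V` a contraction. Since `N = W A B` has finite trace,
`√N` is Hilbert-Schmidt, and Cauchy-Schwarz for `V √N` and `√N` gives `Tr N`. -/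
theorem re_trace_mul_le_traceNorm {A B : Op X} (hA : IsHS A) (hB : IsHS B) :
    (trace (A * B)).re ≤ traceNorm (A * B) := by
  obtain ⟨W, -, hW⟩ := exists_contraction_sqrt_eq (A * B)
  obtain ⟨V, hV1, hV⟩ := exists_contraction_mul_sqrt_eq (A * B)
  rw [traceNorm]
  set N := CFC.sqrt (star (A * B) * (A * B)) with hN
  have hNpos : N.IsPositive := isPositive_sqrt _
  have hr : IsHS (CFC.sqrt N) := by
    rw [IsHS, hsSq_sqrt_eq_ofReal_of_hasSum hNpos
      (by rw [hW, ← mul_assoc]; exact hasSum_trace_mul (basis X) (hA.mul_left W) hB)]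
    exact ENNReal.ofReal_ne_top
  have e : A * B = V * CFC.sqrt N * CFC.sqrt N := by
    rw [mul_assoc, sqrt_mul_sqrt hNpos]; exact hV
  rw [trace_eq_hsSq_sqrt hNpos, Complex.ofReal_re, ← hsNorm_sq, e, sq]
  exact (re_trace_mul_le (hr.mul_left V) hr).trans
    (mul_le_mul_of_nonneg_right (hsNorm_mul_le_of_norm_le_one hr hV1) (hsNorm_nonneg _))

theorem traceNorm_nonneg (A : Op X) : 0 ≤ traceNorm A :=
  re_trace_nonneg_of_isPositive (isPositive_sqrt _)

/-- The trace norm of `A B` is bounded by the Bhattacharyya coefficient of the outcome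
distributions of any two-outcome measurement. -/
theorem traceNorm_mul_le {A B T : Op X} (hA : IsHS A) (hB : IsHS B) (hA' : IsSelfAdjoint A)
    (hT : T.IsPositive) (hT' : (1 - T).IsPositive) :
    traceNorm (A * B) ≤ hsNorm (CFC.sqrt T * A) * hsNorm (CFC.sqrt T * B) +
      hsNorm (CFC.sqrt (1 - T) * A) * hsNorm (CFC.sqrt (1 - T) * B) := by
  obtain ⟨W, hW1, hW⟩ := exists_contraction_sqrt_eq (A * B)
  have key : ∀ S : Op X, S.IsPositive →
      (trace (W * A * (S * B))).re ≤ hsNorm (CFC.sqrt S * A) * hsNorm (CFC.sqrt S * B) := by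
    intro S hS
    have e : W * A * (S * B) = (W * (A * CFC.sqrt S)) * (CFC.sqrt S * B) := by
      nth_rw 1 [← sqrt_mul_sqrt hS]; simp only [mul_assoc]
    have hn : hsNorm (A * CFC.sqrt S) = hsNorm (CFC.sqrt S * A) := by
      rw [← hsNorm_star, star_mul, star_sqrt, hA'.star_eq]
    rw [e, ← hn]
    exact (re_trace_mul_le ((hA.mul_right _).mul_left W) (hB.mul_left _)).trans
      (mul_le_mul_of_nonneg_right (hsNorm_mul_le_of_norm_le_one (hA.mul_right _) hW1)
        (hsNorm_nonneg _))
  -- Inserting `T + (1 - T) = 1` between `A` and `B` allows Cauchy-Schwarz on each outcome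
  -- separately.
  have e : W * (A * B) = W * A * (T * B + (1 - T) * B) := by
    rw [← add_mul, add_sub_cancel, one_mul, mul_assoc]
  rw [traceNorm, hW, e, trace_mul_add (hA.mul_left W) (hB.mul_left _) (hB.mul_left _),
    Complex.add_re]
  exact add_le_add (key T hT) (key _ hT')

/-- The expectation of a bounded positive operator in the state `A²`. -/
theorem re_trace_mul_mul_self {A T : Op X} (hA : IsHS A) (hA' : IsSelfAdjoint A)
    (hT : T.IsPositive) : (trace (T * (A * A))).re = hsNorm (CFC.sqrt T * A) ^ 2 := by
  have h := trace_star_mul_self (hA.mul_left (CFC.sqrt T))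
  rw [star_mul, star_sqrt, hA'.star_eq, mul_assoc, ← mul_assoc (CFC.sqrt T), sqrt_mul_sqrt hT,
    trace_mul_comm hA (hA.mul_left T), mul_assoc] at h
  rw [h, Complex.ofReal_re]

/-- The Fuchs-van de Graaf bound for a two-outcome measurement. -/
theorem traceNorm_sq_le {A B T : Op X} (hA : IsHS A) (hB : IsHS B) (hA' : IsSelfAdjoint A)
    (hB' : IsSelfAdjoint B) (hA1 : hsNorm A = 1) (hB1 : hsNorm B = 1)
    (hT : T.IsPositive) (hT' : (1 - T).IsPositive) :
    traceNorm (A * B) ^ 2 ≤ 1 - ((trace (T * (A * A))).re - (trace (T * (B * B))).re) ^ 2 := by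
  have hsum : ∀ {C : Op X}, IsHS C → IsSelfAdjoint C → hsNorm C = 1 →
      hsNorm (CFC.sqrt T * C) ^ 2 + hsNorm (CFC.sqrt (1 - T) * C) ^ 2 = 1 := by
    intro C hC hC' hC1
    have h1 : (trace (C * C)).re = 1 := by
      have := trace_star_mul_self hC
      rw [hC'.star_eq, hC1] at this
      simp [this]
    rw [← re_trace_mul_mul_self hC hC' hT, ← re_trace_mul_mul_self hC hC' hT', ← h1,
      ← mul_assoc, ← mul_assoc, trace_mul_comm (hC.mul_left T) hC,
      trace_mul_comm (hC.mul_left (1 - T)) hC, ← Complex.add_re,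
      ← trace_mul_add hC (hC.mul_left _) (hC.mul_left _), ← add_mul, add_sub_cancel, one_mul]
  have h1 := hsum hA hA' hA1
  have h2 := hsum hB hB' hB1
  have h3 := traceNorm_mul_le hA hB hA' hT hT'
  rw [re_trace_mul_mul_self hA hA' hT, re_trace_mul_mul_self hB hB' hT]
  set a := hsNorm (CFC.sqrt T * A)
  set a' := hsNorm (CFC.sqrt (1 - T) * A)
  set b := hsNorm (CFC.sqrt T * B)
  set b' := hsNorm (CFC.sqrt (1 - T) * B)
  have h4 := pow_le_pow_left₀ (traceNorm_nonneg _) h3 2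
  refine h4.trans ?_
  -- With `a² + a'² = b² + b'² = 1`, bounding the cross term this way turns the square of the sum
  -- into exactly `1 - (a² - b²)²`.
  have e4 : 2 * (a * a') * (b * b') ≤ (a * a') ^ 2 + (b * b') ^ 2 := by
    linarith [two_mul_le_add_sq (a * a') (b * b')]
  clear_value a a' b b'
  have e1 : a' ^ 2 = 1 - a ^ 2 := by linarith
  have e2 : b' ^ 2 = 1 - b ^ 2 := by linarith
  rw [mul_pow, mul_pow, e1, e2] at e4
  calc (a * b + a' * b') ^ 2 = a ^ 2 * b ^ 2 + a' ^ 2 * b' ^ 2 + 2 * (a * a') * (b * b') := by ring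
    _ ≤ _ := by rw [e1, e2]; linarith

end Tests

section MultipleTests

variable {X : Type u} [NormedAddCommGroup X] [InnerProductSpace ℂ X] [CompleteSpace X]

/-! ### A measurement discriminating several nearly orthogonal states -/

theorem trace_mul_mul_self {A : Op X} (hA : IsHS A) (T : Op X) :
    trace (T * (A * A)) = trace (A * (T * A)) := by
  rw [← mul_assoc, trace_mul_comm (hA.mul_left T) hA]

theorem trace_add_mul_mul_self {A : Op X} (hA : IsHS A) (S T : Op X) :
    trace ((S + T) * (A * A)) = trace (S * (A * A)) + trace (T * (A * A)) := by
  rw [trace_mul_mul_self hA, trace_mul_mul_self hA, trace_mul_mul_self hA, add_mul,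
    trace_mul_add hA (hA.mul_left _) (hA.mul_left _)]

theorem trace_sub_mul_mul_self {A : Op X} (hA : IsHS A) (S T : Op X) :
    trace ((S - T) * (A * A)) = trace (S * (A * A)) - trace (T * (A * A)) := by
  rw [eq_sub_iff_add_eq, ← trace_add_mul_mul_self hA, sub_add_cancel]

theorem trace_one_mul_mul_self {A : Op X} (hA : IsHS A) (hA' : IsSelfAdjoint A)
    (hA1 : hsNorm A = 1) : trace (1 * (A * A)) = 1 := by
  have := trace_star_mul_self hA
  rw [hA'.star_eq, hA1] at this
  simp [this]

theorem re_trace_mul_mul_self_nonneg {A T : Op X} (hA : IsHS A) (hA' : IsSelfAdjoint A)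
    (hT : T.IsPositive) : 0 ≤ (trace (T * (A * A))).re := by
  rw [re_trace_mul_mul_self hA hA' hT]; positivity

theorem re_trace_star_mul_mul_mul_self {A : Op X} (hA : IsHS A) (hA' : IsSelfAdjoint A)
    (B : Op X) : (trace (star B * B * (A * A))).re = hsNorm (B * A) ^ 2 := by
  have h := trace_star_mul_self (hA.mul_left B)
  rw [star_mul, hA'.star_eq, mul_assoc, ← mul_assoc (star B), ← trace_mul_mul_self hA] at h
  rw [h, Complex.ofReal_re]

theorem norm_le_one_of_isStarProjection {P : Op X} (hP : IsStarProjection P) : ‖P‖ ≤ 1 := by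
  have h : ‖star P * P‖ = ‖P‖ * ‖P‖ := CStarRing.norm_star_mul_self
  rw [hP.isSelfAdjoint.star_eq, hP.isIdempotentElem.eq] at h
  nlinarith [norm_nonneg P]

theorem hsNorm_mul_isStarProjection {A P : Op X} (hA : IsSelfAdjoint A)
    (hP : IsStarProjection P) : hsNorm (A * P) = hsNorm (P * A) := by
  rw [← hsNorm_star, star_mul, hA.star_eq, hP.isSelfAdjoint.star_eq]

variable {M : ℕ} {A : Fin M → Op X} {δ : ℝ}

theorem exists_test_against_sum (hA : ∀ m, IsHS (A m)) (hA' : ∀ m, (A m).IsPositive)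
    (hδ : 0 ≤ δ) (h : ∀ m k, m ≠ k → (trace (A m * A k)).re ≤ δ) (m : Fin M)
    (s : Finset (Fin M)) (hm : m ∉ s) : ∃ P : Op X, IsStarProjection P ∧
      hsNorm ((1 - P) * A m) ≤ √(M * δ) ∧ hsNorm (P * ∑ k ∈ s, A k) ≤ √(M * δ) := by
  obtain ⟨P, hP, hPA⟩ := exists_binary_test (hA m) (isHS_sum s fun k _ => hA k) (hA' m)
    (ContinuousLinearMap.isPositive_sum s fun k _ => hA' k)
  have hle : (trace (A m * ∑ k ∈ s, A k)).re ≤ M * δ := by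
    rw [trace_mul_sum s (hA m) fun k _ => hA k, Complex.re_sum]
    calc ∑ k ∈ s, (trace (A m * A k)).re ≤ ∑ _k ∈ s, δ :=
          Finset.sum_le_sum fun k hk => h m k fun e => hm (e ▸ hk)
      _ = (s.card : ℝ) * δ := by simp
      _ ≤ M * δ := by
          gcongr
          simpa using s.card_le_univ
  exact ⟨P, hP, Real.le_sqrt_of_sq_le (by nlinarith [sq_nonneg (hsNorm (P * ∑ k ∈ s, A k))]),
    Real.le_sqrt_of_sq_le (by nlinarith [sq_nonneg (hsNorm ((1 - P) * A m))])⟩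

/-- Smallness of `P ∑ A k` does not directly bound the single terms, because the cross terms `Tr (A
j P A k)` may be negative. A second test `E`, of `A k` against the remaining sum `Z`, isolates `A
k`: each of the three pieces of `P * A k` in `e` is at most `√(M * δ)`. -/
theorem exists_test_against_each (hA : ∀ m, IsHS (A m)) (hA' : ∀ m, (A m).IsPositive)
    (hδ : 0 ≤ δ) (h : ∀ m k, m ≠ k → (trace (A m * A k)).re ≤ δ) (m : Fin M) :
    ∃ P : Op X, IsStarProjection P ∧ hsNorm ((1 - P) * A m) ≤ √(M * δ) ∧
      ∀ k, k ≠ m → hsNorm (P * A k) ≤ 3 * √(M * δ) := by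
  obtain ⟨P, hP, hP1, hP2⟩ :=
    exists_test_against_sum hA hA' hδ h m (Finset.univ.erase m) (by simp)
  refine ⟨P, hP, hP1, fun k hk => ?_⟩
  obtain ⟨E, hE, hE1, hE2⟩ :=
    exists_test_against_sum hA hA' hδ h k ((Finset.univ.erase m).erase k) (by simp)
  have hPn := norm_le_one_of_isStarProjection hP
  have hEn := norm_le_one_of_isStarProjection hE
  rw [← Finset.sum_erase_add _ _ (show k ∈ Finset.univ.erase m by simp [hk])] at hP2
  set Z : Op X := ∑ x ∈ (Finset.univ.erase m).erase k, A x
  have hZ : IsHS Z := isHS_sum _ fun x _ => hA x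
  have hZ' : IsSelfAdjoint Z :=
    (ContinuousLinearMap.isPositive_sum _ fun x _ => hA' x).isSelfAdjoint
  have e : P * A k = P * (Z + A k) * E - P * (Z * E) + P * (A k * (1 - E)) := by noncomm_ring
  have hEc := hE.one_sub
  rw [e]
  have b1 : hsNorm (P * (Z + A k) * E) ≤ √(M * δ) :=
    (hsNorm_mul_right_le_of_norm_le_one ((hZ.add (hA k)).mul_left P) hEn).trans hP2
  have b2 : hsNorm (P * (Z * E)) ≤ √(M * δ) :=
    (hsNorm_mul_le_of_norm_le_one (hZ.mul_right E) hPn).trans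
      ((hsNorm_mul_isStarProjection hZ' hE).le.trans hE2)
  have b3 : hsNorm (P * (A k * (1 - E))) ≤ √(M * δ) :=
    (hsNorm_mul_le_of_norm_le_one ((hA k).mul_right _) hPn).trans
      ((hsNorm_mul_isStarProjection (hA' k).isSelfAdjoint hEc).le.trans hE1)
  have h1 : IsHS (P * (Z + A k) * E) := ((hZ.add (hA k)).mul_left P).mul_right E
  have h2 : IsHS (P * (Z * E)) := (hZ.mul_right E).mul_left P
  have h3 : IsHS (P * (A k * (1 - E))) := ((hA k).mul_right _).mul_left P
  linarith [hsNorm_add_le (h1.sub h2) h3, hsNorm_sub_le h1 h2]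

/-- The Kraus operator of the event that the first `k` of a sequence of projective tests fail. -/
def seqFail (P : ℕ → Op X) : ℕ → Op X
  | 0 => 1
  | k + 1 => (1 - P k) * seqFail P k

theorem sum_star_mul_seqFail {P : ℕ → Op X} (hP : ∀ k, IsStarProjection (P k)) (n : ℕ) :
    ∑ k ∈ Finset.range n, star (P k * seqFail P k) * (P k * seqFail P k) =
      1 - star (seqFail P n) * seqFail P n := by
  induction n with
  | zero => simp [seqFail]
  | succ n ih =>
    have h1 : ∀ Q : Op X, IsStarProjection Q → star (Q * seqFail P n) * (Q * seqFail P n) =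
        star (seqFail P n) * Q * seqFail P n := fun Q hQ => by
      rw [star_mul, hQ.isSelfAdjoint.star_eq, mul_assoc, ← mul_assoc Q, hQ.isIdempotentElem.eq,
        mul_assoc]
    rw [Finset.sum_range_succ, ih, seqFail, h1 _ (hP n), h1 _ (hP n).one_sub]
    noncomm_ring

/-- Each test that is unlikely to succeed disturbs the amplitude `B` by at most `η`, and
contractions do not enlarge earlier disturbances, so they add up. -/
theorem hsNorm_sub_seqFail_mul_le {P : ℕ → Op X} (hP : ∀ k, IsStarProjection (P k)) {B : Op X}
    (hB : IsHS B) {η : ℝ} (n : ℕ) (h : ∀ k < n, hsNorm (P k * B) ≤ η) :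
    hsNorm (B - seqFail P n * B) ≤ n * η := by
  induction n with
  | zero => simp [seqFail, hsNorm, hsSq]
  | succ n ih =>
    have e : B - seqFail P (n + 1) * B = (1 - P n) * (B - seqFail P n * B) + P n * B := by
      rw [seqFail]; noncomm_ring
    have hs := hB.sub (hB.mul_left (seqFail P n))
    have h1 := hsNorm_add_le (hs.mul_left (1 - P n)) (hB.mul_left (P n))
    have h2 := hsNorm_mul_le_of_norm_le_one hs (norm_le_one_of_isStarProjection (hP n).one_sub)
    have h3 := ih fun k hk => h k (by omega)
    have h4 := h n (by omega)
    rw [e]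
    push_cast
    linarith

/-- Finitely many nearly orthogonal states `A m ^ 2` can be discriminated by one measurement. -/
theorem exists_measurement (hM : 0 < M) (hA : ∀ m, IsHS (A m)) (hA' : ∀ m, (A m).IsPositive)
    (hA1 : ∀ m, hsNorm (A m) = 1) (hδ : 0 ≤ δ)
    (h : ∀ m k, m ≠ k → (trace (A m * A k)).re ≤ δ) :
    ∃ Λ : Fin M → Op X, (∀ m, (Λ m).IsPositive) ∧ ∑ m, Λ m = 1 ∧
      ∀ m, (trace ((1 - Λ m) * (A m * A m))).re ≤ 6 * M * √(M * δ) := by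
  choose P hP hP1 hP2 using exists_test_against_each hA hA' hδ h
  set η := √(M * δ) with hη
  have hη0 : 0 ≤ η := Real.sqrt_nonneg _
  let Q : ℕ → Op X := fun j => if hj : j < M then P ⟨j, hj⟩ else 0
  have hQ : ∀ j, IsStarProjection (Q j) := fun j => by
    simp only [Q]
    split_ifs
    · exact hP _
    · exact IsStarProjection.zero (Op X)
  have hQm : ∀ m : Fin M, Q m = P m := fun m => by simp [Q]
  let B : ℕ → Op X := fun j => Q j * seqFail Q j
  have hpos : ∀ C : Op X, (star C * C).IsPositive := fun C =>
    (ContinuousLinearMap.nonneg_iff_isPositive _).1 (star_mul_self_nonneg C)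
  have hrest : ∀ m : Fin M, (if (m : ℕ) = 0 then star (seqFail Q M) * seqFail Q M
      else 0 : Op X).IsPositive := fun m => by
    split_ifs
    · exact hpos _
    · exact ContinuousLinearMap.isPositive_zero
  -- Outcome `m` means that test `m` is the first to succeed; the event that all tests fail is
  -- assigned to outcome `0`.
  refine ⟨fun m => star (B m) * B m +
    if (m : ℕ) = 0 then star (seqFail Q M) * seqFail Q M else 0,
    fun m => (hpos _).add (hrest m), ?_, fun m => ?_⟩
  · rw [Finset.sum_add_distrib, Fin.sum_univ_eq_sum_range (fun j => star (B j) * B j),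
      sum_star_mul_seqFail hQ,
      Fin.sum_univ_eq_sum_range
        (fun j => (if j = 0 then star (seqFail Q M) * seqFail Q M else 0 : Op X)),
      Finset.sum_ite_eq_of_mem' _ _ _ (by simpa using hM), sub_add_cancel]
  · have hsa := (hA' m).isSelfAdjoint
    rw [trace_sub_mul_mul_self (hA m), trace_one_mul_mul_self (hA m) hsa (hA1 m),
      trace_add_mul_mul_self (hA m), Complex.sub_re, Complex.add_re,
      re_trace_star_mul_mul_mul_self (hA m) hsa, Complex.one_re]
    have h0 := re_trace_mul_mul_self_nonneg (hA m) hsa (hrest m)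
    have h1 : hsNorm (A m - seqFail Q m * A m) ≤ (m : ℕ) * (3 * η) := by
      refine hsNorm_sub_seqFail_mul_le hQ (hA m) m fun k hk => ?_
      have hkM : k < M := hk.trans m.2
      have := hP2 ⟨k, hkM⟩ m (by rw [ne_eq, Fin.ext_iff]; simp; omega)
      simpa [Q, hkM] using this
    have e : A m - B m * A m = P m * (A m - seqFail Q m * A m) + (1 - P m) * A m := by
      simp only [B, hQm]; noncomm_ring
    have hs := (hA m).sub ((hA m).mul_left (seqFail Q m))
    have h2 := hsNorm_add_le (hs.mul_left (P m)) ((hA m).mul_left (1 - P m))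
    rw [← e] at h2
    have h3 := hsNorm_mul_le_of_norm_le_one hs (norm_le_one_of_isStarProjection (hP m))
    have h4 := hP1 m
    have h5 : hsNorm (A m) ≤ hsNorm (A m - B m * A m) + hsNorm (B m * A m) := by
      have := hsNorm_add_le ((hA m).sub ((hA m).mul_left (B m))) ((hA m).mul_left (B m))
      rwa [sub_add_cancel] at this
    rw [hA1] at h5
    have h6 : ((m : ℕ) : ℝ) + 1 ≤ M := by exact_mod_cast m.2
    -- At most `m` earlier tests cost `3 η` each and test `m` itself costs `η`. Passing from
    -- amplitude to probability by `1 - x² ≤ 2 (1 - x)` doubles `3` to `6`.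
    have h7 : ((m : ℕ) : ℝ) * (3 * η) + η ≤ 3 * M * η := by nlinarith
    have h8 : 1 - hsNorm (B m * A m) ^ 2 ≤ 2 * (1 - hsNorm (B m * A m)) := by
      nlinarith [sq_nonneg (1 - hsNorm (B m * A m))]
    linarith

end MultipleTests

section Tensor

variable {X Y : HilbSp.{u}}

/-! ### Tensor products of operators -/

/-- The elementary tensor `x ⊗ y` in the Hilbert space tensor product, linear in `x`. -/
def tmulLeft (X : HilbSp.{u}) {Y : HilbSp.{u}} (y : Y) : X →L[ℂ] tensorSp X Y :=
  (UniformSpace.Completion.toComplL : X ⊗[ℂ] Y →L[ℂ] _).comp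
    ((TensorProduct.mkL ℂ X Y).flip y)

/-- The elementary tensor `x ⊗ y` in the Hilbert space tensor product, linear in `y`. -/
def tmulRight {X : HilbSp.{u}} (Y : HilbSp.{u}) (x : X) : Y →L[ℂ] tensorSp X Y :=
  (UniformSpace.Completion.toComplL : X ⊗[ℂ] Y →L[ℂ] _).comp (TensorProduct.mkL ℂ X Y x)

/-- The elementary tensor `x ⊗ y` in the Hilbert space tensor product. -/
def tmul (x : X) (y : Y) : tensorSp X Y :=
  ((x ⊗ₜ[ℂ] y : X ⊗[ℂ] Y) : UniformSpace.Completion (X ⊗[ℂ] Y))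

theorem inner_tmul_tmul (x x' : X) (y y' : Y) :
    ⟪tmul x y, tmul x' y'⟫_ℂ = ⟪x, x'⟫_ℂ * ⟪y, y'⟫_ℂ :=
  UniformSpace.Completion.inner_coe _ _

theorem tensorOp_tmul (A : Op X) (B : Op Y) (x : X) (y : Y) :
    tensorOp A B (tmul x y) = tmul (A x) (B y) :=
  ContinuousLinearMap.completion_apply_coe (TensorProduct.mapL A B) _

theorem op_ext_tmul {Z : Type*} [NormedAddCommGroup Z] [NormedSpace ℂ Z]
    {S T : tensorSp X Y →L[ℂ] Z} (h : ∀ x y, S (tmul x y) = T (tmul x y)) : S = T := by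
  have hd : DenseRange ((↑) : X ⊗[ℂ] Y → UniformSpace.Completion (X ⊗[ℂ] Y)) :=
    UniformSpace.Completion.denseRange_coe
  refine ContinuousLinearMap.coeFn_injective (hd.equalizer S.continuous T.continuous ?_)
  ext t
  induction t using TensorProduct.induction_on with
  | zero => exact (map_zero S).trans (map_zero T).symm
  | tmul x y => exact h x y
  | add s t hs ht =>
    have hadd : ∀ R : tensorSp X Y →L[ℂ] Z, R ((s + t : X ⊗[ℂ] Y) : UniformSpace.Completion _) =
        R ((s : X ⊗[ℂ] Y) : UniformSpace.Completion _) +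
          R ((t : X ⊗[ℂ] Y) : UniformSpace.Completion _) := fun R =>
      (congrArg R (UniformSpace.Completion.coe_add s t)).trans (map_add R _ _)
    exact (hadd S).trans ((congrArg₂ (· + ·) hs ht).trans (hadd T).symm)

theorem eq_zero_of_inner_tmul {z : tensorSp X Y} (h : ∀ x y, ⟪z, tmul x y⟫_ℂ = 0) : z = 0 := by
  have h2 : innerSL ℂ z = 0 := op_ext_tmul fun x y => by simpa using h x y
  have h3 := DFunLike.congr_fun h2 z
  simpa using h3

theorem tensorOp_mul (A A' : Op X) (B B' : Op Y) :
    tensorOp A B * tensorOp A' B' = tensorOp (A * A') (B * B') :=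
  op_ext_tmul fun x y => by
    rw [mul_apply_eq_comp, tensorOp_tmul, tensorOp_tmul, tensorOp_tmul]; rfl

theorem star_tensorOp (A : Op X) (B : Op Y) :
    star (tensorOp A B) = tensorOp (star A) (star B) := by
  refine op_ext_tmul fun x y => ?_
  rw [← sub_eq_zero]
  refine eq_zero_of_inner_tmul fun x' y' => ?_
  rw [inner_sub_left, ContinuousLinearMap.star_eq_adjoint,
    ContinuousLinearMap.adjoint_inner_left, tensorOp_tmul, tensorOp_tmul, inner_tmul_tmul,
    inner_tmul_tmul, ContinuousLinearMap.star_eq_adjoint, ContinuousLinearMap.star_eq_adjoint,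
    ContinuousLinearMap.adjoint_inner_left, ContinuousLinearMap.adjoint_inner_left, sub_self]

theorem orthonormal_tmul {ι κ : Type*} (b : HilbertBasis ι ℂ X) (c : HilbertBasis κ ℂ Y) :
    Orthonormal ℂ fun i : ι × κ => (tmul (b i.1) (c i.2) : tensorSp X Y) := by
  classical
  rw [orthonormal_iff_ite]
  rintro ⟨i, j⟩ ⟨i', j'⟩
  rw [inner_tmul_tmul, orthonormal_iff_ite.1 b.orthonormal, orthonormal_iff_ite.1 c.orthonormal]
  simp [← ite_and, and_comm]

theorem eq_zero_of_inner_basis_tmul {ι κ : Type*} (b : HilbertBasis ι ℂ X)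
    (c : HilbertBasis κ ℂ Y) {z : tensorSp X Y}
    (h : ∀ i j, ⟪z, tmul (b i) (c j)⟫_ℂ = 0) : z = 0 := by
  have h1 : ∀ j x, ⟪z, tmul x (c j)⟫_ℂ = 0 := fun j x => by
    have : (innerSL ℂ z).comp (tmulLeft X (c j)) = 0 := by
      refine ContinuousLinearMap.ext_on (s := Set.range b)
        (Submodule.dense_iff_topologicalClosure_eq_top.2 b.dense_span) ?_
      rintro _ ⟨i, rfl⟩
      exact h i j
    exact DFunLike.congr_fun this x
  refine eq_zero_of_inner_tmul fun x y => ?_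
  have : (innerSL ℂ z).comp (tmulRight Y x) = 0 := by
    refine ContinuousLinearMap.ext_on (s := Set.range c)
      (Submodule.dense_iff_topologicalClosure_eq_top.2 c.dense_span) ?_
    rintro _ ⟨j, rfl⟩
    exact h1 j x
  exact DFunLike.congr_fun this y

/-- The product of two Hilbert bases. -/
def tensorBasis {ι κ : Type*} (b : HilbertBasis ι ℂ X) (c : HilbertBasis κ ℂ Y) :
    HilbertBasis (ι × κ) ℂ (tensorSp X Y) :=
  HilbertBasis.mkOfOrthogonalEqBot (orthonormal_tmul b c) (by
    rw [Submodule.eq_bot_iff]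
    intro z hz
    refine eq_zero_of_inner_basis_tmul b c fun i j => ?_
    exact (Submodule.mem_orthogonal' _ _).1 hz _ (Submodule.subset_span ⟨(i, j), rfl⟩))

theorem tensorBasis_apply {ι κ : Type*} (b : HilbertBasis ι ℂ X) (c : HilbertBasis κ ℂ Y)
    (i : ι × κ) : tensorBasis b c i = tmul (b i.1) (c i.2) := by
  rw [tensorBasis, HilbertBasis.coe_mkOfOrthogonalEqBot]

theorem enorm_tmul (x : X) (y : Y) : ‖tmul x y‖ₑ = ‖x‖ₑ * ‖y‖ₑ := by
  have h : ‖tmul x y‖ = ‖x‖ * ‖y‖ :=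
    (UniformSpace.Completion.norm_coe _).trans (TensorProduct.norm_tmul x y)
  rw [← ofReal_norm, h, ENNReal.ofReal_mul (norm_nonneg _), ofReal_norm, ofReal_norm]

theorem hsSq_tensorOp (A : Op X) (B : Op Y) : hsSq (tensorOp A B) = hsSq A * hsSq B := by
  have h : ∀ p, ‖tensorOp A B (tensorBasis (basis X) (basis Y) p)‖ₑ ^ 2 =
      ‖A (basis X p.1)‖ₑ ^ 2 * ‖B (basis Y p.2)‖ₑ ^ 2 := fun p => by
    rw [tensorBasis_apply, tensorOp_tmul, enorm_tmul, mul_pow]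
  rw [hsSq_eq_tsum (tensorBasis (basis X) (basis Y)), tsum_congr h,
    ENNReal.tsum_prod (f := fun i j => ‖A (basis X i)‖ₑ ^ 2 * ‖B (basis Y j)‖ₑ ^ 2), hsSq, hsSq,
    ← ENNReal.tsum_mul_right]
  exact tsum_congr fun i => ENNReal.tsum_mul_left

theorem IsHS.tensorOp {A : Op X} {B : Op Y} (hA : IsHS A) (hB : IsHS B) :
    IsHS (tensorOp A B) := by
  rw [IsHS, hsSq_tensorOp]; exact ENNReal.mul_ne_top hA hB

theorem hsInner_tensorOp {A A' : Op X} {B B' : Op Y} (hA : IsHS A) (hA' : IsHS A')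
    (hB : IsHS B) (hB' : IsHS B') :
    hsInner (tensorOp A B) (tensorOp A' B') = hsInner A A' * hsInner B B' := by
  let f : basisIndex X → ℂ := fun i => ⟪A (basis X i), A' (basis X i)⟫_ℂ
  let g : basisIndex Y → ℂ := fun j => ⟪B (basis Y j), B' (basis Y j)⟫_ℂ
  have hf : HasSum f (hsInner A A') := hasSum_hsInner (basis X) hA hA'
  have hg : HasSum g (hsInner B B') := hasSum_hsInner (basis Y) hB hB'
  have e : (fun p => ⟪tensorOp A B (tensorBasis (basis X) (basis Y) p),
      tensorOp A' B' (tensorBasis (basis X) (basis Y) p)⟫_ℂ) = fun p => f p.1 * g p.2 := by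
    ext p
    rw [tensorBasis_apply, tensorOp_tmul, tensorOp_tmul, inner_tmul_tmul]
  have h := hasSum_hsInner (tensorBasis (basis X) (basis Y)) (hA.tensorOp hB) (hA'.tensorOp hB')
  rw [e] at h
  exact h.unique (hf.mul hg h.summable)

theorem hsSq_id_unitSp : hsSq (ContinuousLinearMap.id ℂ (unitSp : HilbSp.{u})) = 1 := by
  have b : HilbertBasis PUnit.{u + 1} ℂ (unitSp : HilbSp.{u}) :=
    (EuclideanSpace.basisFun PUnit.{u + 1} ℂ).toHilbertBasis
  rw [hsSq_eq_tsum b, tsum_fintype]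
  simp [← ofReal_norm, b.orthonormal.1]

/-! ### Tensor powers of operators -/

theorem powOp_mul (A B : Op X) (n : ℕ) : powOp A n * powOp B n = powOp (A * B) n := by
  induction n with
  | zero => exact ContinuousLinearMap.id_comp _
  | succ n ih => exact (tensorOp_mul A B (powOp A n) (powOp B n)).trans (congrArg _ ih)

theorem star_powOp (A : Op X) (n : ℕ) : star (powOp A n) = powOp (star A) n := by
  induction n with
  | zero => exact ContinuousLinearMap.adjoint_id
  | succ n ih => exact (star_tensorOp A (powOp A n)).trans (congrArg _ ih)

theorem isPositive_powOp {A : Op X} (hA : A.IsPositive) (n : ℕ) : (powOp A n).IsPositive := by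
  have h : powOp A n = star (powOp (CFC.sqrt A) n) * powOp (CFC.sqrt A) n := by
    rw [star_powOp, star_sqrt, powOp_mul, sqrt_mul_sqrt hA]
  rw [← ContinuousLinearMap.nonneg_iff_isPositive, h]
  exact star_mul_self_nonneg _

theorem sqrt_powOp {A : Op X} (hA : A.IsPositive) (n : ℕ) :
    CFC.sqrt (powOp A n) = powOp (CFC.sqrt A) n :=
  CFC.sqrt_unique (by rw [powOp_mul, sqrt_mul_sqrt hA])
    ((ContinuousLinearMap.nonneg_iff_isPositive _).2 (isPositive_powOp (isPositive_sqrt A) n))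

theorem hsSq_powOp (A : Op X) (n : ℕ) : hsSq (powOp A n) = hsSq A ^ n := by
  induction n with
  | zero => rw [pow_zero]; exact hsSq_id_unitSp
  | succ n ih => rw [pow_succ', ← ih]; exact hsSq_tensorOp A (powOp A n)

theorem IsHS.powOp {A : Op X} (hA : IsHS A) (n : ℕ) : IsHS (powOp A n) := by
  rw [IsHS, hsSq_powOp]; exact ENNReal.pow_ne_top hA

theorem hsNorm_powOp (A : Op X) (n : ℕ) : hsNorm (powOp A n) = hsNorm A ^ n := by
  rw [← sq_eq_sq₀ (hsNorm_nonneg _) (pow_nonneg (hsNorm_nonneg _) _), hsNorm_sq, hsSq_powOp,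
    ENNReal.toReal_pow, ← hsNorm_sq, pow_right_comm]

theorem hsInner_self {H : Type u} [NormedAddCommGroup H] [InnerProductSpace ℂ H]
    [CompleteSpace H] {A : Op H} (hA : IsHS A) : hsInner A A = ((hsNorm A ^ 2 : ℝ) : ℂ) := by
  rw [← trace_star_mul_self hA, trace_mul_eq_hsInner hA.star hA, star_star]

theorem hsInner_powOp {A B : Op X} (hA : IsHS A) (hB : IsHS B) (n : ℕ) :
    hsInner (powOp A n) (powOp B n) = hsInner A B ^ n := by
  induction n with
  | zero =>
    have h : hsSq (powOp A 0) = 1 := hsSq_id_unitSp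
    refine (hsInner_self (hA.powOp 0)).trans ?_
    rw [hsNorm_sq, h]; simp
  | succ n ih =>
    rw [pow_succ', ← ih]
    exact hsInner_tensorOp hA hB (hA.powOp n) (hB.powOp n)

theorem trace_powOp_mul {A B : Op X} (hA : IsHS A) (hB : IsHS B) (n : ℕ) :
    trace (powOp A n * powOp B n) = trace (A * B) ^ n := by
  rw [trace_mul_eq_hsInner (hA.powOp n) (hB.powOp n), star_powOp,
    hsInner_powOp hA.star hB, trace_mul_eq_hsInner hA hB]

/-- Square roots commute with tensor powers, so `|A ^ ⊗n| = |A| ^ ⊗n`; a second square root turns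
the trace into `hsSq`, which is multiplicative. -/
theorem traceNorm_powOp (A : Op X) (n : ℕ) : traceNorm (powOp A n) = traceNorm A ^ n := by
  have h0 : (star A * A).IsPositive :=
    (ContinuousLinearMap.nonneg_iff_isPositive _).1 (star_mul_self_nonneg A)
  rw [traceNorm, traceNorm, star_powOp, powOp_mul, sqrt_powOp h0,
    trace_eq_hsSq_sqrt (isPositive_powOp (isPositive_sqrt _) n),
    sqrt_powOp (isPositive_sqrt _), hsSq_powOp, trace_eq_hsSq_sqrt (isPositive_sqrt _),
    ENNReal.toReal_pow, Complex.ofReal_re, Complex.ofReal_re]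

end Tensor

section HypothesisTesting

/-! ### Error probabilities of hypothesis tests -/

theorem IsState.isHS_sqrt {X : HilbSp.{u}} {ρ : Op X} (h : IsState ρ) : IsHS (CFC.sqrt ρ) := by
  rw [IsHS, hsSq_sqrt_eq_ofReal_of_hasSum h.isPositive h.hasSum_trace]
  exact ENNReal.ofReal_ne_top

theorem IsState.hsNorm_sqrt {X : HilbSp.{u}} {ρ : Op X} (h : IsState ρ) :
    hsNorm (CFC.sqrt ρ) = 1 := by
  rw [hsNorm, hsSq_sqrt_eq_ofReal_of_hasSum h.isPositive h.hasSum_trace]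
  simp

theorem IsState.hsNorm_powOp_sqrt {X : HilbSp.{u}} {ρ : Op X} (h : IsState ρ) (n : ℕ) :
    hsNorm (powOp (CFC.sqrt ρ) n) = 1 := by
  rw [hsNorm_powOp, h.hsNorm_sqrt, one_pow]

theorem IsState.powOp_sqrt_mul_self {X : HilbSp.{u}} {ρ : Op X} (h : IsState ρ) (n : ℕ) :
    powOp (CFC.sqrt ρ) n * powOp (CFC.sqrt ρ) n = powOp ρ n := by
  rw [powOp_mul, sqrt_mul_sqrt h.isPositive]

theorem IsState.re_trace_mul_powOp_nonneg {X : HilbSp.{u}} {ρ : Op X} (h : IsState ρ) (n : ℕ)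
    {T : Op (powSp X n)} (hT : T.IsPositive) : 0 ≤ (trace (T * powOp ρ n)).re := by
  rw [← h.powOp_sqrt_mul_self]
  exact re_trace_mul_mul_self_nonneg (h.isHS_sqrt.powOp n)
    (isPositive_powOp (isPositive_sqrt ρ) n).isSelfAdjoint hT

theorem holevoFidelity_le_fidelity {X : HilbSp.{u}} {ρ σ : Op X} (hρ : IsState ρ)
    (hσ : IsState σ) : holevoFidelity ρ σ ≤ fidelity ρ σ :=
  pow_le_pow_left₀ (re_trace_mul_nonneg hρ.isHS_sqrt hσ.isHS_sqrt (isPositive_sqrt ρ)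
    (isPositive_sqrt σ)) (re_trace_mul_le_traceNorm hρ.isHS_sqrt hσ.isHS_sqrt) 2

variable {X : HilbSp.{u}} {M : ℕ} {p : Fin M → ℝ} {ρ : Fin M → Op X} {ε : ℝ}

namespace POVM

theorem isPositive_one_sub_sub (Λ : POVM X M) {m k : Fin M} (hmk : m ≠ k) :
    (1 - Λ.op m - Λ.op k).IsPositive := by
  have h : 1 - Λ.op m - Λ.op k = ∑ j ∈ (Finset.univ.erase m).erase k, Λ.op j := by
    rw [← Λ.sum_eq, ← Finset.add_sum_erase _ _ (Finset.mem_univ m),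
      ← Finset.add_sum_erase _ _ (show k ∈ Finset.univ.erase m by simp [hmk.symm])]
    abel
  rw [h]
  exact ContinuousLinearMap.isPositive_sum _ fun j _ => Λ.isPositive j

theorem isPositive_one_sub (Λ : POVM X M) (m : Fin M) : (1 - Λ.op m).IsPositive := by
  have h : 1 - Λ.op m = ∑ j ∈ Finset.univ.erase m, Λ.op j := by
    rw [← Λ.sum_eq, ← Finset.add_sum_erase _ _ (Finset.mem_univ m)]
    abel
  rw [h]
  exact ContinuousLinearMap.isPositive_sum _ fun j _ => Λ.isPositive j

theorem nonempty (X : HilbSp.{u}) (m : Fin M) : Nonempty (POVM X M) :=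
  ⟨⟨fun k => if k = m then 1 else 0, fun k => by
    split_ifs
    · exact ContinuousLinearMap.isPositive_one
    · exact ContinuousLinearMap.isPositive_zero, by simp⟩⟩

end POVM

theorem IsEnsemble.error_term_nonneg (h : IsEnsemble p ρ) (n : ℕ) (Λ : POVM (powSp X n) M)
    (m : Fin M) : 0 ≤ p m * (trace ((1 - Λ.op m) * powOp (ρ m) n)).re :=
  mul_nonneg (h.prior_pos m).le
    ((h.isState m).re_trace_mul_powOp_nonneg n (Λ.isPositive_one_sub m))

theorem IsEnsemble.minError_le_errorOf (h : IsEnsemble p ρ) (n : ℕ) (Λ : POVM (powSp X n) M) :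
    minError p ρ n ≤ errorOf p ρ n Λ :=
  ciInf_le ⟨0, by
    rintro _ ⟨Λ', rfl⟩
    exact Finset.sum_nonneg fun m _ => h.error_term_nonneg n Λ' m⟩ Λ

/-- The quotient increases with `p k`, and `p k ≤ 1 - p m`. -/
theorem IsEnsemble.le_prior_mul (h : IsEnsemble p ρ) {m k : Fin M} (hmk : m ≠ k)
    (hε : ε ≤ p m * p k / (p m + p k)) : ε ≤ p m * (1 - p m) := by
  have h1 := h.prior_pos m
  have h2 := h.prior_pos k
  have h3 : p m + p k ≤ 1 := by
    rw [← h.prior_sum, ← Finset.sum_pair hmk]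
    exact Finset.sum_le_sum_of_subset_of_nonneg (Finset.subset_univ _)
      fun i _ _ => (h.prior_pos i).le
  refine hε.trans ((div_le_iff₀ (by positivity)).2 ?_)
  nlinarith [mul_nonneg (sq_nonneg (p m)) (sub_nonneg.2 h3)]

/-- A small error probability forces all pairs of states to have small fidelity. -/
theorem IsEnsemble.fidelity_pow_le (h : IsEnsemble p ρ) (hε0 : 0 < ε) {m k : Fin M}
    (hmk : m ≠ k) (hε : ε ≤ p m * p k / (p m + p k)) {n : ℕ} (hn : minError p ρ n ≤ ε) :
    fidelity (ρ m) (ρ k) ^ n ≤ 1 - ε ^ 2 / 4 := by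
  have := POVM.nonempty (powSp X n) m
  -- The infimum need not be attained; the slack `ε ^ 2 / 2` is small enough for `key` below.
  obtain ⟨Λ, hΛ⟩ := exists_lt_of_ciInf_lt (hn.trans_lt (show ε < ε + ε ^ 2 / 2 by
    linarith [pow_pos hε0 2]))
  have hm := h.isState m
  have hk := h.isState k
  have hA := hm.isHS_sqrt.powOp n
  have hB := hk.isHS_sqrt.powOp n
  have hA' := (isPositive_powOp (isPositive_sqrt (ρ m)) n).isSelfAdjoint
  have hB' := (isPositive_powOp (isPositive_sqrt (ρ k)) n).isSelfAdjoint
  have hF := traceNorm_sq_le hA hB hA' hB' (hm.hsNorm_powOp_sqrt n) (hk.hsNorm_powOp_sqrt n)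
    (Λ.isPositive m) (Λ.isPositive_one_sub m)
  rw [hm.powOp_sqrt_mul_self, hk.powOp_sqrt_mul_self, powOp_mul, traceNorm_powOp,
    pow_right_comm] at hF
  refine hF.trans ?_
  set a := (trace (Λ.op m * powOp (ρ m) n)).re
  set c := (trace (Λ.op m * powOp (ρ k) n)).re
  have ha : (trace ((1 - Λ.op m) * powOp (ρ m) n)).re = 1 - a := by
    rw [← hm.powOp_sqrt_mul_self, trace_sub_mul_mul_self hA,
      trace_one_mul_mul_self hA hA' (hm.hsNorm_powOp_sqrt n), hm.powOp_sqrt_mul_self,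
      Complex.sub_re, Complex.one_re]
  -- Answering `m` when the state is `ρ k` is an error, as `Λ m ≤ 1 - Λ k`.
  have hc : c ≤ (trace ((1 - Λ.op k) * powOp (ρ k) n)).re := by
    have h0 := hk.re_trace_mul_powOp_nonneg n (Λ.isPositive_one_sub_sub hmk.symm)
    rw [← hk.powOp_sqrt_mul_self, trace_sub_mul_mul_self hB, hk.powOp_sqrt_mul_self,
      Complex.sub_re] at h0
    exact sub_nonneg.1 h0
  have herr : p m * (1 - a) + p k * c < ε + ε ^ 2 / 2 := by
    refine lt_of_le_of_lt ?_ hΛ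
    calc p m * (1 - a) + p k * c
        ≤ ∑ j ∈ {m, k}, p j * (trace ((1 - Λ.op j) * powOp (ρ j) n)).re := by
          rw [Finset.sum_pair hmk, ha]
          exact add_le_add le_rfl (mul_le_mul_of_nonneg_left hc (h.prior_pos k).le)
      _ ≤ errorOf p ρ n Λ :=
          Finset.sum_le_sum_of_subset_of_nonneg (Finset.subset_univ _)
            fun j _ _ => h.error_term_nonneg n Λ j
  have ha0 : 0 ≤ 1 - a := ha ▸ hm.re_trace_mul_powOp_nonneg n (Λ.isPositive_one_sub m)
  have hc0 : 0 ≤ c := hk.re_trace_mul_powOp_nonneg n (Λ.isPositive m)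
  -- Used with `r` the smaller of the two priors. The contradiction rests on `r ≥ ε` and `(1 - ε) *
  -- (1 + ε / 2) ≤ 1 - ε / 2`.
  have key : ∀ r : ℝ, 0 < r → ε ≤ r * (1 - r) → r * ((1 - a) + c) < ε + ε ^ 2 / 2 →
      ε / 2 ≤ a - c := by
    intro r hr h1 h2
    by_contra! h3
    have h4 : ε ≤ r := by nlinarith
    have h5 : r * (1 - ε / 2) < r * ((1 - a) + c) := mul_lt_mul_of_pos_left (by linarith) hr
    have h6 : ε * (1 + ε / 2) ≤ r * (1 - r) * (1 + ε / 2) :=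
      mul_le_mul_of_nonneg_right h1 (by linarith)
    have h7 : r * ((1 - r) * (1 + ε / 2)) ≤ r * (1 - ε / 2) :=
      mul_le_mul_of_nonneg_left (by nlinarith) hr.le
    linarith
  have hac : ε / 2 ≤ a - c := by
    rcases le_total (p m) (p k) with hle | hle
    · exact key (p m) (h.prior_pos m) (h.le_prior_mul hmk hε) (by nlinarith)
    · exact key (p k) (h.prior_pos k)
        (h.le_prior_mul hmk.symm (by rwa [mul_comm, add_comm])) (by nlinarith)
  nlinarith

/-- Small Holevo fidelities allow for a measurement with small error probability. -/
theorem IsEnsemble.minError_le (h : IsEnsemble p ρ) (hM : 0 < M) {δ : ℝ} (hδ : 0 ≤ δ) {n : ℕ}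
    (hF : ∀ m k, m ≠ k → holevoFidelity (ρ m) (ρ k) ^ n ≤ δ ^ 2) :
    minError p ρ n ≤ 6 * M * √(M * δ) := by
  have htr : ∀ m k, m ≠ k →
      (trace (powOp (CFC.sqrt (ρ m)) n * powOp (CFC.sqrt (ρ k)) n)).re ≤ δ := by
    intro m k hmk
    have hm := (h.isState m).isHS_sqrt
    have hk := (h.isState k).isHS_sqrt
    have hreal : trace (CFC.sqrt (ρ m) * CFC.sqrt (ρ k)) =
        ((trace (CFC.sqrt (ρ m) * CFC.sqrt (ρ k))).re : ℂ) := by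
      refine (Complex.conj_eq_iff_re.1 ?_).symm
      rw [starRingEnd_apply, ← trace_star, star_mul, star_sqrt, star_sqrt, trace_mul_comm hk hm]
    rw [trace_powOp_mul hm hk, hreal, ← Complex.ofReal_pow, Complex.ofReal_re]
    refine le_of_sq_le_sq ?_ hδ
    rw [pow_right_comm]
    exact hF m k hmk
  obtain ⟨Λ, h1, h2, h3⟩ := exists_measurement hM (fun m => (h.isState m).isHS_sqrt.powOp n)
    (fun m => isPositive_powOp (isPositive_sqrt (ρ m)) n)
    (fun m => (h.isState m).hsNorm_powOp_sqrt n) hδ htr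
  refine (h.minError_le_errorOf n ⟨Λ, h1, h2⟩).trans ?_
  calc errorOf p ρ n ⟨Λ, h1, h2⟩ ≤ ∑ m, p m * (6 * M * √(M * δ)) := by
        refine Finset.sum_le_sum fun m _ => mul_le_mul_of_nonneg_left ?_ (h.prior_pos m).le
        have := h3 m
        rwa [(h.isState m).powOp_sqrt_mul_self] at this
    _ = 6 * M * √(M * δ) := by rw [← Finset.sum_mul, h.prior_sum, one_mul]

end HypothesisTesting

section SampleComplexity

/-! ### Bounds on the sample complexity -/

theorem negLog_antitone {x y : ℝ} (h : x ≤ y) : negLog y ≤ negLog x := by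
  unfold negLog
  split_ifs with h1 h2 h2
  · exact le_rfl
  · exact absurd (h.trans h1) h2
  · exact le_top
  · exact ENNReal.ofReal_le_ofReal (neg_le_neg (Real.log_le_log (not_le.1 h2) h))

theorem pow_le_exp_neg_of_le_mul_negLog {x K : ℝ} (hx : 0 ≤ x) {n : ℕ} (hn : 1 ≤ n)
    (hK : 0 < K) (h : ENNReal.ofReal K ≤ n * negLog x) : x ^ n ≤ Real.exp (-K) := by
  rcases hx.eq_or_lt with rfl | hx
  · rw [zero_pow (by omega)]; positivity
  · rw [negLog, if_neg (not_le.2 hx), ← ENNReal.ofReal_natCast, ← ENNReal.ofReal_mul (by simp)] at h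
    have h1 : K ≤ n * -Real.log x := by
      by_contra! h2
      exact absurd h (not_le.2 ((ENNReal.ofReal_lt_ofReal_iff hK).2 h2))
    rw [← Real.exp_log (pow_pos hx n), Real.log_pow]
    exact Real.exp_le_exp.2 (by linarith)

theorem le_mul_negLog_of_pow_le {x κ : ℝ} {n : ℕ} (hn : 1 ≤ n) (h : x ^ n ≤ 1 - κ) :
    ENNReal.ofReal κ ≤ n * negLog x := by
  unfold negLog
  split_ifs with hx
  · rw [ENNReal.mul_top (by simpa using by omega)]; exact le_top
  · rw [← ENNReal.ofReal_natCast, ← ENNReal.ofReal_mul (by simp)]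
    refine ENNReal.ofReal_le_ofReal ?_
    have hp := pow_pos (not_le.1 hx) n
    have h1 := Real.log_le_sub_one_of_pos hp
    rw [Real.log_pow] at h1
    linarith

theorem le_sampleComplexity {X : HilbSp.{u}} {M : ℕ} {p : Fin M → ℝ} {ρ : Fin M → Op X} {ε : ℝ}
    {b : ℝ≥0∞} (h : ∀ n : ℕ, 1 ≤ n → minError p ρ n ≤ ε → b ≤ n) :
    b ≤ (sampleComplexity p ρ ε : ℝ≥0∞) := by
  by_cases hex : ∃ n : ℕ, 1 ≤ n ∧ minError p ρ n ≤ ε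
  · classical
    obtain ⟨h1, h2⟩ := Nat.find_spec hex
    refine (h _ h1 h2).trans ?_
    rw [← ENat.toENNReal_coe, ENat.toENNReal_le]
    exact le_iInf₂ fun n hn => by exact_mod_cast Nat.find_min' hex hn
  · have : sampleComplexity p ρ ε = ⊤ := by
      simp only [not_exists] at hex
      simp [sampleComplexity, hex]
    rw [this]; simp

theorem sampleComplexity_le {X : HilbSp.{u}} {M : ℕ} {p : Fin M → ℝ} {ρ : Fin M → Op X} {ε : ℝ}
    {n : ℕ} (hn : 1 ≤ n) (h : minError p ρ n ≤ ε) :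
    (sampleComplexity p ρ ε : ℝ≥0∞) ≤ n := by
  rw [← ENat.toENNReal_coe, ENat.toENNReal_le]
  exact iInf₂_le n ⟨hn, h⟩

/-- Rounding `L / D` down keeps the bound `max 1 (L / D)` exact. The price is a factor `2`, since
`max 1 ⌊y⌋ ≥ y / 2`. -/
theorem exists_nat_le_max_one_div {D : ℝ≥0∞} (hD : D ≠ 0) {L : ℝ} (hL : 0 ≤ L) :
    ∃ n : ℕ, 1 ≤ n ∧ (n : ℝ≥0∞) ≤ max 1 (ENNReal.ofReal L / D) ∧
      ENNReal.ofReal (L / 2) ≤ n * D := by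
  rcases eq_or_ne D ∞ with rfl | hD'
  · exact ⟨1, le_rfl, by simp, by simp⟩
  lift D to NNReal using hD'
  have hD0 : 0 < (D : ℝ) := by
    rw [NNReal.coe_pos, pos_iff_ne_zero]; exact_mod_cast hD
  have e : ENNReal.ofReal L / D = ENNReal.ofReal (L / D) := by
    rw [ENNReal.ofReal_div_of_pos hD0, ENNReal.ofReal_coe_nnreal]
  refine ⟨max 1 ⌊L / D⌋₊, le_max_left _ _, ?_, ?_⟩
  · rw [e]
    rcases le_total 1 ⌊L / D⌋₊ with h1 | h1
    · rw [max_eq_right h1, ← ENNReal.ofReal_natCast]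
      exact le_max_of_le_right (ENNReal.ofReal_le_ofReal (Nat.floor_le (by positivity)))
    · rw [max_eq_left h1]
      simp
  · rw [← ENNReal.ofReal_coe_nnreal, ← ENNReal.ofReal_natCast, ← ENNReal.ofReal_mul (by simp)]
    refine ENNReal.ofReal_le_ofReal ?_
    have h1 := Nat.lt_floor_add_one (L / D)
    have h2 : ((max 1 ⌊L / D⌋₊ : ℕ) : ℝ) ≥ 1 := by exact_mod_cast le_max_left _ _
    have h3 : ((max 1 ⌊L / D⌋₊ : ℕ) : ℝ) ≥ ⌊L / D⌋₊ := by exact_mod_cast le_max_right _ _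
    have h4 : L / D / 2 ≤ ((max 1 ⌊L / D⌋₊ : ℕ) : ℝ) := by linarith
    calc L / 2 = L / D / 2 * D := by field_simp
      _ ≤ _ := mul_le_mul_of_nonneg_right h4 hD0.le

variable {X : HilbSp.{u}} {M : ℕ} {p : Fin M → ℝ} {ρ : Fin M → Op X} {ε : ℝ}

theorem minNegLog_le (G : Op X → Op X → ℝ) {m k : Fin M} (hmk : m ≠ k) :
    minNegLog G ρ ≤ negLog (G (ρ m) (ρ k)) :=
  (iInf_le _ m).trans ((iInf_le _ k).trans (iInf_le _ hmk))

theorem IsEnsemble.minNegLog_fidelity_le (h : IsEnsemble p ρ) :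
    minNegLog fidelity ρ ≤ minNegLog holevoFidelity ρ :=
  le_iInf fun m => le_iInf fun k => le_iInf fun hmk => (minNegLog_le fidelity hmk).trans
    (negLog_antitone (holevoFidelity_le_fidelity (h.isState m) (h.isState k)))

theorem IsEnsemble.div_minNegLog_le_sampleComplexity (h : IsEnsemble p ρ) (hε0 : 0 < ε)
    (hε : ∀ m k : Fin M, m ≠ k → ε ≤ p m * p k / (p m + p k)) :
    ENNReal.ofReal (ε ^ 2 / 4) / minNegLog fidelity ρ ≤ (sampleComplexity p ρ ε : ℝ≥0∞) := by
  refine le_sampleComplexity fun n hn hne => ENNReal.div_le_of_le_mul ?_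
  have hn0 : (n : ℝ≥0∞) ≠ 0 := by simpa using by omega
  rw [mul_comm, ← ENNReal.div_le_iff_le_mul (Or.inl hn0) (Or.inl (ENNReal.natCast_ne_top n))]
  refine le_iInf fun m => le_iInf fun k => le_iInf fun hmk => ENNReal.div_le_of_le_mul ?_
  rw [mul_comm]
  exact le_mul_negLog_of_pow_le hn (h.fidelity_pow_le hε0 hmk (hε m k hmk) hne)

theorem IsEnsemble.card_mul_le_one (h : IsEnsemble p ρ) (hM : 2 ≤ M)
    (hε : ∀ m k : Fin M, m ≠ k → ε ≤ p m * p k / (p m + p k)) : M * ε ≤ 1 := by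
  have hle : ∀ m, ε ≤ p m := fun m => by
    have : Nontrivial (Fin M) := Fin.nontrivial_iff_two_le.2 hM
    obtain ⟨k, hk⟩ := exists_ne m
    have h1 := h.le_prior_mul hk.symm (hε m k hk.symm)
    nlinarith [h.prior_pos m]
  calc (M : ℝ) * ε = ∑ _m : Fin M, ε := by simp
    _ ≤ ∑ m, p m := Finset.sum_le_sum fun m _ => hle m
    _ = 1 := h.prior_sum

theorem IsEnsemble.sampleComplexity_le_max (h : IsEnsemble p ρ) (hM : 2 ≤ M) (hε0 : 0 < ε)
    (hε1 : ε ≤ 1) (hε : ∀ m k : Fin M, m ≠ k → ε ≤ p m * p k / (p m + p k)) {C : ℝ}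
    (hC : C = 2 * -Real.log ((ε ^ 5 / 36) ^ 2) / Real.log 2) :
    (sampleComplexity p ρ ε : ℝ≥0∞) ≤
      max 1 (ENNReal.ofReal (C * Real.log M) / minNegLog holevoFidelity ρ) := by
  -- With `M * ε ≤ 1` this gives `√(M * δ) ≤ ε ^ 2 / 6`, hence `6 * M * √(M * δ) ≤ ε`. In `C`, the
  -- `2` pays for rounding down and `Real.log 2` is absorbed by `Real.log M`.
  set δ := ε ^ 5 / 36 with hδ
  have hδ0 : 0 < δ := by positivity
  have hδ1 : δ < 1 := by
    have := pow_le_one₀ hε0.le hε1 (n := 5)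
    rw [hδ]; linarith
  have hK : 0 < -Real.log (δ ^ 2) :=
    neg_pos.2 (Real.log_neg (by positivity) (pow_lt_one₀ hδ0.le hδ1 two_ne_zero))
  have hlog2 : 0 < Real.log 2 := Real.log_pos one_lt_two
  have hlogM : Real.log 2 ≤ Real.log M := Real.log_le_log two_pos (by exact_mod_cast hM)
  have hC0 : 0 < C := by rw [hC]; positivity
  have hCM : -Real.log (δ ^ 2) ≤ C * Real.log M / 2 := by
    calc -Real.log (δ ^ 2) = C * Real.log 2 / 2 := by rw [hC]; field_simp
      _ ≤ _ := by gcongr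
  rcases eq_or_ne (minNegLog holevoFidelity ρ) 0 with hD | hD
  · rw [hD, ENNReal.div_zero (by simpa using mul_pos hC0 (hlog2.trans_le hlogM))]
    simp
  obtain ⟨n, hn1, hn2, hn3⟩ :=
    exists_nat_le_max_one_div hD (mul_pos hC0 (hlog2.trans_le hlogM)).le
  refine (sampleComplexity_le hn1 ?_).trans hn2
  have hF : ∀ m k, m ≠ k → holevoFidelity (ρ m) (ρ k) ^ n ≤ δ ^ 2 := fun m k hmk => by
    have := pow_le_exp_neg_of_le_mul_negLog (x := holevoFidelity (ρ m) (ρ k)) (sq_nonneg _) hn1 hK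
      ((ENNReal.ofReal_le_ofReal hCM).trans
        (hn3.trans (mul_le_mul_right (minNegLog_le holevoFidelity hmk) _)))
    rwa [neg_neg, Real.exp_log (by positivity)] at this
  refine (h.minError_le (by omega) hδ0.le hF).trans ?_
  have hMε := h.card_mul_le_one hM hε
  have hs : √(M * δ) ≤ ε ^ 2 / 6 := by
    refine Real.sqrt_le_iff.2 ⟨by positivity, ?_⟩
    calc (M : ℝ) * δ = M * ε * (ε ^ 4 / 36) := by rw [hδ]; ring
      _ ≤ 1 * (ε ^ 4 / 36) := by gcongr
      _ = (ε ^ 2 / 6) ^ 2 := by ring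
  calc 6 * (M : ℝ) * √(M * δ) ≤ 6 * M * (ε ^ 2 / 6) := by gcongr
    _ = M * ε * ε := by ring
    _ ≤ 1 * ε := by gcongr
    _ = ε := one_mul ε

end SampleComplexity

end QHT

end

theorem corollary7 (ε : ℝ) (hε0 : 0 < ε) (hε1 : ε ≤ 1) :
    ∃ c C : ℝ, 0 < c ∧ 0 < C ∧
      ∀ (X : QHT.HilbSp.{u}) (_ : TopologicalSpace.SeparableSpace X) (M : ℕ) (_ : 2 ≤ M)
        (p : Fin M → ℝ) (ρ : Fin M → QHT.Op X) (_ : QHT.IsEnsemble p ρ)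
        (_ : ∀ m m' : Fin M, m ≠ m' → ε ≤ p m * p m' / (p m + p m')),
        (ENNReal.ofReal c / QHT.minNegLog QHT.fidelity ρ ≤
            (QHT.sampleComplexity p ρ ε : ℝ≥0∞) ∧
          (QHT.sampleComplexity p ρ ε : ℝ≥0∞) ≤
            max 1 (ENNReal.ofReal (C * Real.log M) / QHT.minNegLog QHT.fidelity ρ)) ∧
        (ENNReal.ofReal c / QHT.minNegLog QHT.holevoFidelity ρ ≤
            (QHT.sampleComplexity p ρ ε : ℝ≥0∞) ∧
          (QHT.sampleComplexity p ρ ε : ℝ≥0∞) ≤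
            max 1 (ENNReal.ofReal (C * Real.log M) / QHT.minNegLog QHT.holevoFidelity ρ)) := by
  have hδ : (ε ^ 5 / 36) ^ 2 < 1 := by
    have := pow_le_one₀ hε0.le hε1 (n := 5)
    exact pow_lt_one₀ (by positivity) (by linarith) two_ne_zero
  refine ⟨ε ^ 2 / 4, 2 * -Real.log ((ε ^ 5 / 36) ^ 2) / Real.log 2, by positivity, ?_, ?_⟩
  · have := neg_pos.2 (Real.log_neg (by positivity) hδ)
    have := Real.log_pos one_lt_two
    positivity
  · intro X _ M hM p ρ h hε
    have hD := h.minNegLog_fidelity_le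
    have hlow := h.div_minNegLog_le_sampleComplexity hε0 hε
    have hup := h.sampleComplexity_le_max hM hε0 hε1 hε rfl
    exact ⟨⟨hlow, hup.trans (max_le_max le_rfl (ENNReal.div_le_div_left hD _))⟩,
      ⟨(ENNReal.div_le_div_left hD _).trans hlow, hup⟩⟩
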